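/- Let $d\ge 1$ and let $\widehat D=\{x\in\mathbb R^d:\ x_i>-1,\ \sum_{i=1}^d(x_i+1)<2\}$ be the bi-unit reference simplex (the bi-unit triangle for $d=2$, the bi-unit tetrahedron for $d=3$). An affine element is a set $D=\Phi(\widehat D)$ with $\Phi:\mathbb R^d\to\mathbb R^d$ an invertible affine map; put $h=\operatorname{diam}(D)$. It is called quasi-regular with constant $\sigma$ if it contains a ball of some radius $r>0$ with $h\le \sigma\cdot 2r$. For $N\ge 0$ let $P^N(D)=\{p\circ\Phi^{-1}: p \text{ a polynomial of total degree}\le N\}$, and let $\Pi_N:L^2(D)\to P^N(D)$ be the $L^2(D)$-orthogonal projection. With weak derivatives $D^\alpha$, put $$\|u\|_{W^{s,2}(D)}=\Big(\sum_{|\alpha|\le s}\|D^\alpha u\|_{L^2(D)}^2\Big)^{1/2},\qquad \|w\|_{W^{s,\infty}(D)}=\max_{|\alpha|\le s}\|D^\alpha w\|_{L^\infty(D)}.$$ For all $d\ge1$, $N\ge 0$ and $\sigma$ there is a constant $C$, depending only on $d$, $N$ and $\sigma$, such that for every affine element $D$ that is quasi-regular with constant $\sigma$, every real-valued $w\in W^{N+1,\infty}(D)$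 with $w\ne 0$ almost everywhere on $D$, and every real-valued $u\in W^{N+1,2}(D)$, one has $uw\in L^2(D)$ and $$\Big\|u-\frac1w\,\Pi_N(uw)\Big\|_{L^2(D)}\le C\,h^{N+1}\,\Big\|\frac1w\Big\|_{L^\infty(D)}\|w\|_{W^{N+1,\infty}(D)}\|u\|_{W^{N+1,2}(D)}.$$ (The inequality is in $[0,\infty]$, with $0\cdot\infty=0$.) -/

import Mathlib

open MeasureTheory Set
open scoped ENNReal NNReal

/-- Multi-indices `α ∈ ℕ^d` of order `|α| = α₁ + ⋯ + α_d ≤ s`. -/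
def multiIndices (d s : ℕ) : Finset (Fin d → ℕ) :=
  (Fintype.piFinset fun _ : Fin d => Finset.range (s + 1)).filter fun α => ∑ i, α i ≤ s

theorem mem_multiIndices {d s : ℕ} {α : Fin d → ℕ} :
    α ∈ multiIndices d s ↔ ∑ i, α i ≤ s := by
  simp only [multiIndices, Finset.mem_filter, Fintype.mem_piFinset, Finset.mem_range,
    and_iff_right_iff_imp]
  intro h i
  have := Finset.single_le_sum (f := α) (fun _ _ => Nat.zero_le _) (Finset.mem_univ i)
  omega

/-- The classical partial derivative `∂φ/∂xᵢ`. -/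
noncomputable def partialDeriv {d : ℕ} (i : Fin d) (φ : EuclideanSpace ℝ (Fin d) → ℝ) :
    EuclideanSpace ℝ (Fin d) → ℝ :=
  fun x => fderiv ℝ φ x (EuclideanSpace.single i 1)

/-- The classical derivative `D^α φ = ∂₁^{α₁} ⋯ ∂_d^{α_d} φ` (used for smooth `φ` only). -/
noncomputable def multiDeriv {d : ℕ} (α : Fin d → ℕ) (φ : EuclideanSpace ℝ (Fin d) → ℝ) :
    EuclideanSpace ℝ (Fin d) → ℝ :=
  (List.finRange d).foldr (fun i g => (partialDeriv i)^[α i] g) φ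

/-- `v` is a weak derivative `D^α u` on the open set `Ω`: both are locally integrable on `Ω`, and
`∫_Ω u D^α φ = (-1)^{|α|} ∫_Ω v φ` for every test function `φ ∈ C_c^∞(Ω)`. -/
def HasWeakDeriv {d : ℕ} (Ω : Set (EuclideanSpace ℝ (Fin d))) (α : Fin d → ℕ)
    (u v : EuclideanSpace ℝ (Fin d) → ℝ) : Prop :=
  LocallyIntegrableOn u Ω ∧ LocallyIntegrableOn v Ω ∧
    ∀ φ : EuclideanSpace ℝ (Fin d) → ℝ, ContDiff ℝ ((⊤ : ℕ∞) : WithTop ℕ∞) φ →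
      HasCompactSupport φ → tsupport φ ⊆ Ω →
      ∫ x in Ω, u x * multiDeriv α φ x = (-1) ^ (∑ i, α i) * ∫ x in Ω, v x * φ x

open Classical in
/-- The weak derivative `D^α u` on `Ω` (unique up to null sets; `0` if there is none). -/
noncomputable def weakDeriv {d : ℕ} (Ω : Set (EuclideanSpace ℝ (Fin d))) (α : Fin d → ℕ)
    (u : EuclideanSpace ℝ (Fin d) → ℝ) : EuclideanSpace ℝ (Fin d) → ℝ :=
  if h : ∃ v, HasWeakDeriv Ω α u v then h.choose else 0

/-- `u ∈ W^{s,p}(Ω)`: `u ∈ L^p(Ω)` and for all `|α| ≤ s` the weak derivative `D^α u` exists and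
belongs to `L^p(Ω)`. -/
def MemSobolev {d : ℕ} (Ω : Set (EuclideanSpace ℝ (Fin d))) (s : ℕ) (p : ℝ≥0∞)
    (u : EuclideanSpace ℝ (Fin d) → ℝ) : Prop :=
  MemLp u p (volume.restrict Ω) ∧
    ∀ α ∈ multiIndices d s, ∃ v, HasWeakDeriv Ω α u v ∧ MemLp v p (volume.restrict Ω)

/-- The norm of `W^{s,p}(Ω)`: `(∑_{|α| ≤ s} ‖D^α u‖_{L^p}^p)^{1/p}` for `p < ∞`, and
`max_{|α| ≤ s} ‖D^α u‖_{L^∞}` for `p = ∞`. -/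
noncomputable def sobolevNorm {d : ℕ} (Ω : Set (EuclideanSpace ℝ (Fin d))) (s : ℕ) (p : ℝ≥0∞)
    (u : EuclideanSpace ℝ (Fin d) → ℝ) : ℝ≥0∞ :=
  if p = ∞ then
    (multiIndices d s).sup fun α => eLpNorm (weakDeriv Ω α u) ∞ (volume.restrict Ω)
  else
    (∑ α ∈ multiIndices d s, eLpNorm (weakDeriv Ω α u) p (volume.restrict Ω) ^ p.toReal) ^
      (1 / p.toReal)

/-- The (open) bi-unit reference simplex: the simplex with vertices `(-1, …, -1)` and
`(-1, …, -1) + 2 eᵢ`. For `d = 2` it is the bi-unit triangle `{x, y > -1, x + y < 0}`, for `d = 3`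
the bi-unit tetrahedron `{x, y, z > -1, x + y + z < -1}`. -/
def refSimplex (d : ℕ) : Set (EuclideanSpace ℝ (Fin d)) :=
  {x | (∀ i, -1 < x i) ∧ ∑ i, (x i + 1) < 2}

/-- The (open) affine element: the image of the reference simplex under an invertible affine
elemental mapping `Φ`. -/
def affineElement {d : ℕ} (Φ : EuclideanSpace ℝ (Fin d) ≃ᴬ[ℝ] EuclideanSpace ℝ (Fin d)) :
    Set (EuclideanSpace ℝ (Fin d)) :=
  Φ '' refSimplex d

/-- Quasi-regularity (shape regularity, non-degeneracy) with constant `σ`: `D` contains a ball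
whose diameter `2 r` satisfies `diam D ≤ σ · 2 r`. -/
def IsQuasiRegular {d : ℕ} (σ : ℝ) (D : Set (EuclideanSpace ℝ (Fin d))) : Prop :=
  ∃ (c : EuclideanSpace ℝ (Fin d)) (r : ℝ), 0 < r ∧ Metric.ball c r ⊆ D ∧
    Metric.diam D ≤ σ * (2 * r)

/-- A polynomial on the reference element, mapped to the element: `p ∘ Φ⁻¹`. -/
noncomputable def mappedPoly {d : ℕ}
    (Φ : EuclideanSpace ℝ (Fin d) ≃ᴬ[ℝ] EuclideanSpace ℝ (Fin d)) (p : MvPolynomial (Fin d) ℝ) :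
    EuclideanSpace ℝ (Fin d) → ℝ :=
  fun x => MvPolynomial.eval (fun i => Φ.symm x i) p

theorem refSimplex_subset_closedBall (d : ℕ) :
    refSimplex d ⊆ Metric.closedBall 0 (Real.sqrt d) := by
  rintro x ⟨h1, h2⟩
  rw [mem_closedBall_zero_iff, EuclideanSpace.norm_eq]
  apply Real.sqrt_le_sqrt
  calc ∑ i, ‖x i‖ ^ 2 ≤ ∑ _i : Fin d, (1 : ℝ) := by
        refine Finset.sum_le_sum fun i _ => ?_
        have hi : x i + 1 ≤ ∑ j, (x j + 1) :=
          Finset.single_le_sum (f := fun j => x j + 1)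
            (fun j _ => by have := h1 j; linarith) (Finset.mem_univ i)
        have := h1 i
        rw [Real.norm_eq_abs, sq_abs]
        nlinarith
    _ = d := by simp

theorem memLp_mappedPoly {d : ℕ} (Φ : EuclideanSpace ℝ (Fin d) ≃ᴬ[ℝ] EuclideanSpace ℝ (Fin d))
    (p : MvPolynomial (Fin d) ℝ) (q : ℝ≥0∞) :
    MemLp (mappedPoly Φ p) q (volume.restrict (affineElement Φ)) := by
  have hc : Continuous (mappedPoly Φ p) := by
    refine (MvPolynomial.continuous_eval p).comp (continuous_pi fun i => ?_)
    exact (EuclideanSpace.proj i : EuclideanSpace ℝ (Fin d) →L[ℝ] ℝ).continuous.comp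
      Φ.symm.continuous
  have hK : IsCompact (Φ '' Metric.closedBall 0 (Real.sqrt d)) :=
    (isCompact_closedBall _ _).image Φ.continuous
  obtain ⟨B, hB⟩ := hK.exists_bound_of_continuousOn hc.continuousOn
  have hsub : affineElement Φ ⊆ Φ '' Metric.closedBall 0 (Real.sqrt d) :=
    image_mono (refSimplex_subset_closedBall d)
  have : IsFiniteMeasure (volume.restrict (Φ '' Metric.closedBall 0 (Real.sqrt d))) :=
    ⟨by simpa using hK.measure_lt_top⟩
  have h := MemLp.of_bound (p := q)
    (μ := volume.restrict (Φ '' Metric.closedBall 0 (Real.sqrt d)))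
    hc.aestronglyMeasurable B
    ((ae_restrict_iff' hK.measurableSet).2 (Filter.Eventually.of_forall hB))
  exact h.mono_measure (Measure.restrict_mono_set _ hsub)

/-- The polynomials of total degree at most `N` on the reference element, mapped to `L²` of the
element. -/
noncomputable def polyToL2 {d : ℕ}
    (Φ : EuclideanSpace ℝ (Fin d) ≃ᴬ[ℝ] EuclideanSpace ℝ (Fin d)) (N : ℕ) :
    MvPolynomial.restrictTotalDegree (Fin d) ℝ N →ₗ[ℝ]
      Lp ℝ 2 (volume.restrict (affineElement Φ)) where
  toFun p := (memLp_mappedPoly Φ p.1 2).toLp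
  map_add' p q := by
    rw [← MemLp.toLp_add]
    congr 1
    funext x
    simp [mappedPoly]
  map_smul' c p := by
    rw [RingHom.id_apply, ← MemLp.toLp_const_smul]
    congr 1
    funext x
    simp [mappedPoly]

/-- The space `P^N(D)` as a subspace of `L²(D)`, `D` being the element. -/
noncomputable def polySpace {d : ℕ}
    (Φ : EuclideanSpace ℝ (Fin d) ≃ᴬ[ℝ] EuclideanSpace ℝ (Fin d)) (N : ℕ) :
    Submodule ℝ (Lp ℝ 2 (volume.restrict (affineElement Φ))) :=
  LinearMap.range (polyToL2 Φ N)

instance instFiniteDimensionalPolySpace {d : ℕ}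
    (Φ : EuclideanSpace ℝ (Fin d) ≃ᴬ[ℝ] EuclideanSpace ℝ (Fin d)) (N : ℕ) :
    FiniteDimensional ℝ (polySpace Φ N) :=
  inferInstanceAs (FiniteDimensional ℝ (LinearMap.range (polyToL2 Φ N)))

/-- The `L²(D)`-orthogonal projection `Π_N` onto `P^N(D)`. -/
noncomputable def l2Proj {d : ℕ}
    (Φ : EuclideanSpace ℝ (Fin d) ≃ᴬ[ℝ] EuclideanSpace ℝ (Fin d)) (N : ℕ) :
    Lp ℝ 2 (volume.restrict (affineElement Φ)) →L[ℝ]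
      Lp ℝ 2 (volume.restrict (affineElement Φ)) :=
  (polySpace Φ N).starProjection

/-! Once `1/w` is pulled out in L^∞, the claim concerns best approximation. Π_N(uw) is at least as
close to uw in L² as any mapped polynomial of degree ≤ N, so it suffices to find one p with ‖uw − p‖
≤ C h^{N+1} ‖w‖ ‖u‖ in the respective norms.

For smooth g on a bounded convex set K, a Taylor polynomial of g serves as p. The squared integral
remainder, averaged over base points y ∈ K, is at most 2^d h^{2(N+1)} ∫_K |D^{N+1}g|², so some y
does as well as the average (`exists_mappedPoly_approx_of_contDiff`). Affine maps preserve
polynomial degree, and convexity takes the place of scaling to the reference simplex, so the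
constant depends only on d and N.

To reach weak derivatives, u and w are mollified separately. On the eroded set, which is again
convex, D^α of a mollification is the mollification of the weak derivative. The classical Leibniz
rule then bounds D^{N+1} of the product, and no product rule for Sobolev functions is needed. The
resulting polynomials are bounded in L² of one fixed open set, hence subconverge by finite
dimension, and Fatou's lemma carries the estimate to all of D (`exists_mappedPoly_approx_mul`). -/

/-! ### Iterated derivatives in terms of multi-indices. -/

section IteratedPartials

open scoped ContDiff

variable {d : ℕ}

theorem ContDiff.partialDeriv {φ : EuclideanSpace ℝ (Fin d) → ℝ} (hφ : ContDiff ℝ ∞ φ)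
    (i : Fin d) : ContDiff ℝ ∞ (partialDeriv i φ) :=
  (hφ.fderiv_right (m := ∞) (by simp)).clm_apply contDiff_const

theorem ContDiff.foldr_partialDeriv {φ : EuclideanSpace ℝ (Fin d) → ℝ} (hφ : ContDiff ℝ ∞ φ)
    (l : List (Fin d)) : ContDiff ℝ ∞ (l.foldr _root_.partialDeriv φ) := by
  induction l with
  | nil => exact hφ
  | cons i l ih => exact ih.partialDeriv i

theorem partialDeriv_comm {φ : EuclideanSpace ℝ (Fin d) → ℝ} (hφ : ContDiff ℝ ∞ φ)
    (i j : Fin d) : partialDeriv i (partialDeriv j φ) = partialDeriv j (partialDeriv i φ) := by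
  have hd : Differentiable ℝ (fderiv ℝ φ) :=
    (hφ.fderiv_right (m := ∞) (by simp)).differentiable (by simp)
  have key (a b : Fin d) (x) : partialDeriv a (partialDeriv b φ) x =
      fderiv ℝ (fderiv ℝ φ) x (EuclideanSpace.single a 1) (EuclideanSpace.single b 1) := by
    unfold partialDeriv
    rw [fderiv_clm_apply (hd x) (differentiableAt_const _)]
    simp
  funext x
  rw [key, key]
  exact (hφ.contDiffAt.isSymmSndFDerivAt (by
    rw [minSmoothness_of_isRCLikeNormedField]; 
    exact WithTop.coe_le_coe.2 (OrderTop.le_top (2 : ℕ∞)))) _ _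

theorem foldr_partialDeriv_perm {φ : EuclideanSpace ℝ (Fin d) → ℝ} (hφ : ContDiff ℝ ∞ φ)
    {l l' : List (Fin d)} (h : l.Perm l') :
    l.foldr partialDeriv φ = l'.foldr partialDeriv φ := by
  induction h with
  | nil => rfl
  | cons i _ ih => simp only [List.foldr_cons, ih]
  | swap i j l => exact partialDeriv_comm (hφ.foldr_partialDeriv l) _ _
  | trans _ _ ih₁ ih₂ => exact ih₁.trans ih₂

/-- The list in which each index `i` occurs `α i` times. -/
def multiIndexList (α : Fin d → ℕ) : List (Fin d) :=
  (List.finRange d).flatMap fun i => List.replicate (α i) i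

/-- In list form, commutation of partial derivatives becomes invariance under permutations. -/
theorem multiDeriv_eq_foldr (α : Fin d → ℕ) (φ : EuclideanSpace ℝ (Fin d) → ℝ) :
    multiDeriv α φ = (multiIndexList α).foldr partialDeriv φ := by
  have hrep (i : Fin d) (n : ℕ) (g : EuclideanSpace ℝ (Fin d) → ℝ) :
      (partialDeriv i)^[n] g = (List.replicate n i).foldr partialDeriv g := by
    induction n with
    | zero => rfl
    | succ n ih => rw [Function.iterate_succ_apply', ih, List.replicate_succ, List.foldr_cons]
  unfold multiDeriv multiIndexList
  induction List.finRange d with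
  | nil => rfl
  | cons i l ih => rw [List.foldr_cons, ih, List.flatMap_cons, List.foldr_append, hrep]

theorem count_multiIndexList (α : Fin d → ℕ) (i : Fin d) :
    (multiIndexList α).count i = α i := by
  rw [multiIndexList, List.count_flatMap]
  have : (List.count i ∘ fun j => List.replicate (α j) j) = fun j => if j = i then α i else 0 := by
    funext j
    by_cases h : j = i
    · simp [h]
    · simp [h, List.count_replicate]
  rw [this, ← List.ofFn_eq_map, List.sum_ofFn]
  simp

theorem length_multiIndexList (α : Fin d → ℕ) : (multiIndexList α).length = ∑ i, α i := by
  rw [multiIndexList, List.length_flatMap]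
  simp only [List.length_replicate]
  rw [← List.ofFn_eq_map, List.sum_ofFn]

theorem iteratedFDeriv_single_eq_foldr {φ : EuclideanSpace ℝ (Fin d) → ℝ}
    (hφ : ContDiff ℝ ∞ φ) {k : ℕ} (f : Fin k → Fin d) (x : EuclideanSpace ℝ (Fin d)) :
    iteratedFDeriv ℝ k φ x (fun j => EuclideanSpace.single (f j) 1) =
      (List.ofFn f).foldr partialDeriv φ x := by
  induction k generalizing x with
  | zero => simp
  | succ k ih =>
    have hdiff : DifferentiableAt ℝ (iteratedFDeriv ℝ k φ) x :=
      hφ.contDiffAt.differentiableAt_iteratedFDeriv (by exact_mod_cast ENat.natCast_lt_top k)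
    rw [hdiff.iteratedFDeriv_succ_apply_left', List.ofFn_succ, List.foldr_cons]
    have : (fun y => iteratedFDeriv ℝ k φ y
        (Fin.tail fun j => EuclideanSpace.single (f j) (1 : ℝ))) =
        (List.ofFn fun j => f j.succ).foldr partialDeriv φ := by
      funext y
      exact ih (fun j => f j.succ) y
    rw [this]
    rfl

/-- The order of the directions is irrelevant for smooth functions; α counts how often each one
occurs. -/
theorem exists_multiDeriv_eq_iteratedFDeriv_single {φ : EuclideanSpace ℝ (Fin d) → ℝ}
    (hφ : ContDiff ℝ ∞ φ) {k : ℕ} (f : Fin k → Fin d) :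
    ∃ α ∈ multiIndices d k, ∀ x,
      iteratedFDeriv ℝ k φ x (fun j => EuclideanSpace.single (f j) 1) = multiDeriv α φ x := by
  have hp : (multiIndexList fun i => (List.ofFn f).count i).Perm (List.ofFn f) :=
    List.perm_iff_count.2 fun i => count_multiIndexList _ i
  refine ⟨fun i => (List.ofFn f).count i, ?_, fun x => ?_⟩
  · rw [mem_multiIndices, ← length_multiIndexList, hp.length_eq, List.length_ofFn]
  · rw [iteratedFDeriv_single_eq_foldr hφ, multiDeriv_eq_foldr, foldr_partialDeriv_perm hφ hp]

/-- Expand every argument in the standard basis; each coordinate of v is at most ‖v‖ in absolute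
value. -/
theorem norm_continuousMultilinearMap_le_sum_single {k : ℕ}
    (M : ContinuousMultilinearMap ℝ (fun _ : Fin k => EuclideanSpace ℝ (Fin d)) ℝ) :
    ‖M‖ ≤ ∑ f : Fin k → Fin d, ‖M fun j => EuclideanSpace.single (f j) 1‖ := by
  refine M.opNorm_le_bound (by positivity) fun v => ?_
  have hv : v = fun j => ∑ i, v j i • EuclideanSpace.single i (1 : ℝ) := by
    funext j
    ext i
    simp [Pi.single_apply]
  conv_lhs => rw [hv, M.map_sum]
  rw [Finset.sum_mul]
  refine (norm_sum_le _ _).trans (Finset.sum_le_sum fun f _ => ?_)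
  rw [M.map_smul_univ, norm_smul, mul_comm, norm_prod]
  gcongr with j
  exact PiLp.norm_apply_le (v j) (f j)

theorem norm_iteratedFDeriv_le_sum_multiDeriv {φ : EuclideanSpace ℝ (Fin d) → ℝ}
    (hφ : ContDiff ℝ ∞ φ) {k s : ℕ} (hk : k ≤ s) (x : EuclideanSpace ℝ (Fin d)) :
    ‖iteratedFDeriv ℝ k φ x‖ ≤ (d : ℝ) ^ k * ∑ α ∈ multiIndices d s, ‖multiDeriv α φ x‖ := by
  refine (norm_continuousMultilinearMap_le_sum_single _).trans ?_
  calc _ ≤ ∑ _f : Fin k → Fin d, ∑ α ∈ multiIndices d s, ‖multiDeriv α φ x‖ := by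
        refine Finset.sum_le_sum fun f _ => ?_
        obtain ⟨α, hα, h⟩ := exists_multiDeriv_eq_iteratedFDeriv_single hφ f
        rw [h]
        refine Finset.single_le_sum (f := fun α => ‖multiDeriv α φ x‖)
          (fun _ _ => norm_nonneg _) ?_
        exact mem_multiIndices.2 ((mem_multiIndices.1 hα).trans hk)
    _ = _ := by simp

end IteratedPartials

/-! ### Averaged Taylor approximation on convex sets. -/

section BrambleHilbert

open scoped ContDiff Nat

variable {d : ℕ}

/-- Cauchy–Schwarz against the constant 1. It serves both the Taylor remainder on [0,1] and the
mollifier viewed as a probability measure. -/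
theorem sq_lintegral_le {X : Type*} [MeasurableSpace X] (μ : Measure X) {f : X → ℝ≥0∞}
    (hf : AEMeasurable f μ) : (∫⁻ x, f x ∂μ) ^ 2 ≤ μ univ * ∫⁻ x, f x ^ 2 ∂μ := by
  have h := ENNReal.lintegral_mul_le_Lp_mul_Lq μ Real.HolderConjugate.two_two
    (aemeasurable_const (b := (1 : ℝ≥0∞))) hf
  simp only [Pi.mul_apply, one_mul, ENNReal.one_rpow, lintegral_const] at h
  calc _ ≤ _ := pow_le_pow_left' h 2
    _ = _ := by
      rw [mul_pow, ← ENNReal.rpow_mul_natCast, ← ENNReal.rpow_mul_natCast]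
      norm_num

/-- The coordinate `(Φ ξ - y)ᵢ` as a polynomial in `ξ`. -/
noncomputable def coordPoly (Φ : EuclideanSpace ℝ (Fin d) ≃ᴬ[ℝ] EuclideanSpace ℝ (Fin d))
    (y : EuclideanSpace ℝ (Fin d)) (i : Fin d) : MvPolynomial (Fin d) ℝ :=
  MvPolynomial.C ((Φ 0 - y) i) +
    ∑ j, MvPolynomial.C ((Φ (EuclideanSpace.single j 1) - Φ 0) i) * MvPolynomial.X j

theorem totalDegree_coordPoly_le
    (Φ : EuclideanSpace ℝ (Fin d) ≃ᴬ[ℝ] EuclideanSpace ℝ (Fin d))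
    (y : EuclideanSpace ℝ (Fin d)) (i : Fin d) : (coordPoly Φ y i).totalDegree ≤ 1 := by
  refine (MvPolynomial.totalDegree_add _ _).trans (max_le ((MvPolynomial.totalDegree_C _).le.trans zero_le_one) ?_)
  refine MvPolynomial.totalDegree_finsetSum_le fun j _ => ?_
  refine (MvPolynomial.totalDegree_mul _ _).trans ?_
  rw [MvPolynomial.totalDegree_C, MvPolynomial.totalDegree_X]

theorem mappedPoly_coordPoly
    (Φ : EuclideanSpace ℝ (Fin d) ≃ᴬ[ℝ] EuclideanSpace ℝ (Fin d))
    (y : EuclideanSpace ℝ (Fin d)) (i : Fin d) (x : EuclideanSpace ℝ (Fin d)) :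
    mappedPoly Φ (coordPoly Φ y i) x = x i - y i := by
  obtain ⟨ξ, rfl⟩ := Φ.surjective x
  set A := (Φ : EuclideanSpace ℝ (Fin d) →ᴬ[ℝ] EuclideanSpace ℝ (Fin d)).contLinear with hA
  have hΦ (v : EuclideanSpace ℝ (Fin d)) : Φ v = A v + Φ 0 :=
    congrFun (ContinuousAffineMap.decomp
      (Φ : EuclideanSpace ℝ (Fin d) →ᴬ[ℝ] EuclideanSpace ℝ (Fin d))) v
  have hξ : A ξ = ∑ j, ξ j • A (EuclideanSpace.single j 1) := by
    conv_lhs => rw [show ξ = ∑ j, ξ j • EuclideanSpace.single j (1 : ℝ) by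
      ext i; simp [Pi.single_apply]]
    simp
  have h1 : Φ ξ i = (∑ j, ξ j * A (EuclideanSpace.single j 1) i) + Φ 0 i := by
    rw [hΦ ξ, hξ]; simp
  have h2 (j : Fin d) : (Φ (EuclideanSpace.single j 1) - Φ 0) i =
      A (EuclideanSpace.single j 1) i := by
    rw [hΦ]; simp
  simp only [mappedPoly, coordPoly, h2, map_add, map_sum, map_mul, MvPolynomial.eval_C,
    MvPolynomial.eval_X, ContinuousAffineEquiv.symm_apply_apply, h1]
  simp only [PiLp.sub_apply, mul_comm]
  ring

/-- The Taylor polynomial of degree `N` at any point belongs to the mapped polynomials. -/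
theorem exists_mappedPoly_eq_taylor
    (Φ : EuclideanSpace ℝ (Fin d) ≃ᴬ[ℝ] EuclideanSpace ℝ (Fin d)) (N : ℕ)
    (g : EuclideanSpace ℝ (Fin d) → ℝ) (y : EuclideanSpace ℝ (Fin d)) :
    ∃ p ∈ MvPolynomial.restrictTotalDegree (Fin d) ℝ N, ∀ x, mappedPoly Φ p x =
      ∑ k ∈ Finset.range (N + 1),
        (k ! : ℝ)⁻¹ • iteratedFDeriv ℝ k g y (fun _ => x - y) := by
  -- Multilinear expansion of the Taylor terms in the coordinates of x − y. Each coordinate pulls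
  -- back under Φ to degree at most 1, so the k-th term has degree at most k ≤ N.
  refine ⟨∑ k ∈ Finset.range (N + 1), ∑ f : Fin k → Fin d,
    MvPolynomial.C ((k ! : ℝ)⁻¹ *
      iteratedFDeriv ℝ k g y (fun j => EuclideanSpace.single (f j) 1)) *
      ∏ j, coordPoly Φ y (f j), ?_, fun x => ?_⟩
  · rw [MvPolynomial.mem_restrictTotalDegree]
    refine MvPolynomial.totalDegree_finsetSum_le fun k hk => ?_
    refine MvPolynomial.totalDegree_finsetSum_le fun f _ => ?_
    refine (MvPolynomial.totalDegree_mul _ _).trans ?_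
    rw [MvPolynomial.totalDegree_C, zero_add]
    refine (MvPolynomial.totalDegree_finsetProd _ _).trans ?_
    refine (Finset.sum_le_card_nsmul _ _ 1 fun j _ => totalDegree_coordPoly_le _ _ _).trans ?_
    have := Finset.mem_range.1 hk
    simp
    omega
  · have hc (i : Fin d) : MvPolynomial.eval (fun i => Φ.symm x i) (coordPoly Φ y i) =
        x i - y i := mappedPoly_coordPoly Φ y i x
    simp only [mappedPoly, map_sum, map_mul, map_prod, MvPolynomial.eval_C, hc]
    refine Finset.sum_congr rfl fun k _ => ?_
    have hv : (fun _ : Fin k => x - y) =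
        fun _ => ∑ i, (x - y) i • EuclideanSpace.single i (1 : ℝ) := by
      funext j
      ext i
      simp [Pi.single_apply]
    rw [hv, ContinuousMultilinearMap.map_sum, Finset.smul_sum]
    refine Finset.sum_congr rfl fun f _ => ?_
    rw [ContinuousMultilinearMap.map_smul_univ]
    simp only [smul_eq_mul, PiLp.sub_apply]
    ring

theorem lintegral_comp_add_smul (a : EuclideanSpace ℝ (Fin d)) {t : ℝ} (ht : 0 < t)
    (F : EuclideanSpace ℝ (Fin d) → ℝ≥0∞) :
    ∫⁻ x, F (a + t • x) = ENNReal.ofReal (t ^ d)⁻¹ * ∫⁻ x, F x := by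
  have he : MeasurableEmbedding (fun x : EuclideanSpace ℝ (Fin d) => t • x) :=
    (Homeomorph.smulOfNeZero t ht.ne').measurableEmbedding
  rw [← he.lintegral_map (fun x => F (a + x)), Measure.map_addHaar_smul _ ht.ne',
    lintegral_smul_measure, lintegral_add_left_eq_self, finrank_euclideanSpace_fin,
    abs_of_pos (by positivity), smul_eq_mul]

/-- The change of variables costs t⁻ᵈ, which is at most 2ᵈ because t ≥ 1/2. -/
theorem lintegral_contraction_le {K : Set (EuclideanSpace ℝ (Fin d))} (hK : MeasurableSet K)
    {a : EuclideanSpace ℝ (Fin d)} {t : ℝ} (ht : 1 / 2 ≤ t) (h : ∀ x ∈ K, a + t • x ∈ K)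
    (F : EuclideanSpace ℝ (Fin d) → ℝ≥0∞) :
    ∫⁻ x in K, F (a + t • x) ≤ 2 ^ d * ∫⁻ x in K, F x := by
  rw [← lintegral_indicator hK, ← lintegral_indicator hK]
  calc _ ≤ ∫⁻ x, K.indicator F (a + t • x) := by
        refine lintegral_mono fun x => ?_
        by_cases hx : x ∈ K
        · simp [hx, h x hx]
        · simp [hx]
    _ = ENNReal.ofReal (t ^ d)⁻¹ * ∫⁻ x, K.indicator F x :=
        lintegral_comp_add_smul a (by linarith) _
    _ ≤ _ := by
        gcongr
        have h2 : (t ^ d)⁻¹ ≤ 2 ^ d := by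
          rw [← inv_pow]
          have : t⁻¹ ≤ 2 := by rw [inv_le_comm₀ (by linarith) (by norm_num)]; linarith
          have : 0 ≤ t⁻¹ := by positivity
          gcongr
        refine (ENNReal.ofReal_le_ofReal h2).trans ?_
        rw [ENNReal.ofReal_pow (by norm_num)]
        simp

/-- The point y + t(x − y) scales x by t and y by 1 − t, and one of the two factors is at least 1/2.
Integrating first in that variable avoids the singularity of t⁻ᵈ at 0. -/
theorem lintegral_lintegral_segment_le {K : Set (EuclideanSpace ℝ (Fin d))}
    (hK : MeasurableSet K) (hconv : Convex ℝ K) {t : ℝ} (ht : t ∈ Icc (0 : ℝ) 1)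
    {F : EuclideanSpace ℝ (Fin d) → ℝ≥0∞} (hF : Measurable F) :
    ∫⁻ y in K, ∫⁻ x in K, F (y + t • (x - y)) ≤ 2 ^ d * volume K * ∫⁻ x in K, F x := by
  have hmem {x y : EuclideanSpace ℝ (Fin d)} (hx : x ∈ K) (hy : y ∈ K) :
      y + t • (x - y) ∈ K := hconv.add_smul_sub_mem hy hx ht
  have key : 2 ^ d * volume K * ∫⁻ x in K, F x =
      ∫⁻ _ in K, (2 ^ d * ∫⁻ x in K, F x) := by
    rw [lintegral_const, Measure.restrict_apply_univ]; ring
  rw [key]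
  rcases le_total (1 / 2) t with h | h
  · refine setLIntegral_mono' hK fun y hy => ?_
    have e (x : EuclideanSpace ℝ (Fin d)) : y + t • (x - y) = (y - t • y) + t • x := by
      rw [smul_sub]; abel
    simp only [e]
    exact lintegral_contraction_le hK h (fun x hx => e x ▸ hmem hx hy) F
  · have hm : Measurable (Function.uncurry fun y x => F (y + t • (x - y))) :=
      hF.comp (by fun_prop : Measurable fun q : EuclideanSpace ℝ (Fin d) ×
        EuclideanSpace ℝ (Fin d) => q.1 + t • (q.2 - q.1))
    rw [lintegral_lintegral_swap hm.aemeasurable]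
    refine setLIntegral_mono' hK fun x hx => ?_
    have e (y : EuclideanSpace ℝ (Fin d)) : y + t • (x - y) = t • x + (1 - t) • y := by
      rw [smul_sub, sub_smul, one_smul]; abel
    simp only [e]
    exact lintegral_contraction_le hK (by linarith) (fun y hy => e y ▸ hmem hx hy) F

/-- Integral form of the remainder: the weight (1 − t)^N / N! is at most 1, and Cauchy–Schwarz on
[0,1] moves the square inside. -/
theorem enorm_taylor_remainder_sq_le {g : EuclideanSpace ℝ (Fin d) → ℝ} (hg : ContDiff ℝ ∞ g)
    (N : ℕ) (x y : EuclideanSpace ℝ (Fin d)) :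
    ‖g x - ∑ k ∈ Finset.range (N + 1),
        (k ! : ℝ)⁻¹ • iteratedFDeriv ℝ k g y (fun _ => x - y)‖ₑ ^ 2 ≤
      ‖x - y‖ₑ ^ (2 * (N + 1)) *
        ∫⁻ t in Icc (0 : ℝ) 1, ‖iteratedFDeriv ℝ (N + 1) g (y + t • (x - y))‖ₑ ^ 2 := by
  have hcont : Continuous (iteratedFDeriv ℝ (N + 1) g) :=
    hg.continuous_iteratedFDeriv (by exact_mod_cast le_top)
  have hT := map_add_eq_sum_add_integral_iteratedFDeriv (f := g) (x := y) (y := x - y) (n := N)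
    fun t _ => (hg.of_le (by exact_mod_cast le_top)).contDiffAt
  rw [add_sub_cancel] at hT
  have hle : ‖g x - ∑ k ∈ Finset.range (N + 1),
        (k ! : ℝ)⁻¹ • iteratedFDeriv ℝ k g y (fun _ => x - y)‖ₑ ≤
      ‖x - y‖ₑ ^ (N + 1) *
        ∫⁻ t in Icc (0 : ℝ) 1, ‖iteratedFDeriv ℝ (N + 1) g (y + t • (x - y))‖ₑ := by
    rw [hT, add_sub_cancel_left, enorm_smul, intervalIntegral.integral_of_le zero_le_one,
      ← integral_Icc_eq_integral_Ioc]
    have h1 : ‖((N ! : ℝ))⁻¹‖ₑ ≤ 1 := by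
      rw [← ofReal_norm]
      refine ENNReal.ofReal_le_one.2 ?_
      rw [norm_inv, Real.norm_natCast]
      exact inv_le_one_of_one_le₀ (by exact_mod_cast Nat.factorial_pos N)
    refine (mul_le_of_le_one_left' h1).trans ((enorm_integral_le_lintegral_enorm _).trans ?_)
    rw [← lintegral_const_mul' _ _ (by simp)]
    refine setLIntegral_mono' measurableSet_Icc fun t ht => ?_
    rw [enorm_smul]
    have h2 : ‖(1 - t) ^ N‖ₑ ≤ 1 := by
      rw [← ofReal_norm]
      refine ENNReal.ofReal_le_one.2 ?_
      rw [norm_pow]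
      refine pow_le_one₀ (norm_nonneg _) ?_
      rw [Real.norm_of_nonneg (by linarith [ht.2])]
      linarith [ht.1]
    refine (mul_le_of_le_one_left' h2).trans ?_
    rw [← ofReal_norm, ← ofReal_norm, ← ofReal_norm, ← ENNReal.ofReal_pow (norm_nonneg _),
      ← ENNReal.ofReal_mul (by positivity)]
    refine ENNReal.ofReal_le_ofReal ((ContinuousMultilinearMap.le_opNorm _ _).trans ?_)
    simp [mul_comm]
  refine (pow_le_pow_left' hle 2).trans ?_
  rw [mul_pow, ← pow_mul, mul_comm (N + 1) 2]
  gcongr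
  refine (sq_lintegral_le _ ?_).trans ?_
  · exact (Continuous.enorm (by fun_prop)).aemeasurable
  · simp

/-- The Bramble–Hilbert lemma for smooth functions on convex sets. -/
theorem exists_mappedPoly_approx_of_contDiff
    (Φ : EuclideanSpace ℝ (Fin d) ≃ᴬ[ℝ] EuclideanSpace ℝ (Fin d)) (N : ℕ)
    {K : Set (EuclideanSpace ℝ (Fin d))} (hK : MeasurableSet K) (hconv : Convex ℝ K)
    (hK0 : volume K ≠ 0) (hKtop : volume K ≠ ⊤) {h : ℝ≥0∞}
    (hh : ∀ x ∈ K, ∀ y ∈ K, ‖x - y‖ₑ ≤ h) {g : EuclideanSpace ℝ (Fin d) → ℝ}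
    (hg : ContDiff ℝ ∞ g) :
    ∃ p ∈ MvPolynomial.restrictTotalDegree (Fin d) ℝ N,
      ∫⁻ x in K, ‖g x - mappedPoly Φ p x‖ₑ ^ 2 ≤
        h ^ (2 * (N + 1)) * (2 ^ d * ∫⁻ x in K, ‖iteratedFDeriv ℝ (N + 1) g x‖ₑ ^ 2) := by
  have hcont : Continuous (iteratedFDeriv ℝ (N + 1) g) :=
    hg.continuous_iteratedFDeriv (by exact_mod_cast le_top)
  set F : EuclideanSpace ℝ (Fin d) → ℝ≥0∞ := fun x => ‖iteratedFDeriv ℝ (N + 1) g x‖ₑ ^ 2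
    with hFdef
  have hFm : Measurable F := (ENNReal.continuous_pow 2 |>.comp hcont.enorm).measurable
  set G : EuclideanSpace ℝ (Fin d) → ℝ≥0∞ := fun y =>
    ∫⁻ x in K, ∫⁻ t in Icc (0 : ℝ) 1, F (y + t • (x - y)) with hG
  have hGm : Measurable G := by
    refine Measurable.lintegral_prod_right' (f := fun q : _ × _ =>
      ∫⁻ t in Icc (0 : ℝ) 1, F (q.1 + t • (q.2 - q.1))) ?_
    exact Measurable.lintegral_prod_right' (f := fun q : (_ × _) × ℝ =>
      F (q.1.1 + q.2 • (q.1.2 - q.1.1))) (hFm.comp (by fun_prop))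
  have hGint : ∫⁻ y in K, G y ≤ volume K * (2 ^ d * ∫⁻ x in K, F x) := by
    have e1 (y : EuclideanSpace ℝ (Fin d)) : G y =
        ∫⁻ t in Icc (0 : ℝ) 1, ∫⁻ x in K, F (y + t • (x - y)) :=
      lintegral_lintegral_swap (hFm.comp (by fun_prop)).aemeasurable
    simp only [e1]
    rw [lintegral_lintegral_swap]
    · calc _ ≤ ∫⁻ _ in Icc (0 : ℝ) 1, 2 ^ d * volume K * ∫⁻ x in K, F x :=
            setLIntegral_mono' measurableSet_Icc fun t ht =>
              lintegral_lintegral_segment_le hK hconv ht hFm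
        _ = _ := by simp; ring
    · refine Measurable.aemeasurable ?_
      exact Measurable.lintegral_prod_right' (f := fun q : (_ × ℝ) × _ =>
        F (q.1.1 + q.1.2 • (q.2 - q.1.1))) (hFm.comp (by fun_prop))
  -- Some base point does no worse than the mean of `G` over `K`; the division by the volume of `K`
  -- cancels the volume factor in `hGint`.
  obtain ⟨y, hyK, hy⟩ : ∃ y ∈ K, G y ≤ 2 ^ d * ∫⁻ x in K, F x := by
    obtain ⟨y, hyK, hy⟩ := exists_le_setLAverage hK0 hKtop hGm.aemeasurable.restrict
    refine ⟨y, hyK, hy.trans ?_⟩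
    rw [setLAverage_eq]
    refine ENNReal.div_le_of_le_mul ?_
    rw [mul_comm]
    exact hGint
  obtain ⟨p, hp, hpe⟩ := exists_mappedPoly_eq_taylor Φ N g y
  refine ⟨p, hp, ?_⟩
  refine le_trans ?_ (mul_le_mul_right hy _)
  rw [hG]
  have hm : Measurable fun x => ∫⁻ t in Icc (0 : ℝ) 1, F (y + t • (x - y)) :=
    Measurable.lintegral_prod_right' (f := fun q : _ × ℝ =>
      F (y + q.2 • (q.1 - y))) (hFm.comp (by fun_prop))
  rw [← lintegral_const_mul _ hm]
  refine setLIntegral_mono' hK fun x hx => ?_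
  rw [hpe]
  refine (enorm_taylor_remainder_sq_le hg N x y).trans ?_
  gcongr
  exact hh x hx y hyK

end BrambleHilbert

/-! ### Convolution with bump functions. -/

section Mollification

open scoped ContDiff Convolution
open ContinuousLinearMap (lsmul)

variable {d : ℕ}

theorem HasCompactSupport.partialDeriv {ψ : EuclideanSpace ℝ (Fin d) → ℝ}
    (hψ : HasCompactSupport ψ) (i : Fin d) : HasCompactSupport (partialDeriv i ψ) :=
  (hψ.fderiv ℝ).comp_left
    (g := fun A : EuclideanSpace ℝ (Fin d) →L[ℝ] ℝ => A (EuclideanSpace.single i 1)) (by simp)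

theorem HasCompactSupport.foldr_partialDeriv {ψ : EuclideanSpace ℝ (Fin d) → ℝ}
    (hψ : HasCompactSupport ψ) (l : List (Fin d)) :
    HasCompactSupport (l.foldr _root_.partialDeriv ψ) := by
  induction l with
  | nil => exact hψ
  | cons i l ih => exact ih.partialDeriv i

theorem partialDeriv_convolution {ψ v : EuclideanSpace ℝ (Fin d) → ℝ}
    (hψ : ContDiff ℝ ∞ ψ) (hc : HasCompactSupport ψ) (hv : LocallyIntegrable v) (i : Fin d) :
    partialDeriv i (ψ ⋆[lsmul ℝ ℝ] v) = partialDeriv i ψ ⋆[lsmul ℝ ℝ] v := by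
  funext x
  have h := hc.hasFDerivAt_convolution_left (lsmul ℝ ℝ) (hψ.of_le (by simp)) hv x
  unfold partialDeriv
  rw [h.fderiv, convolution_def, convolution_def, ContinuousLinearMap.integral_apply]
  · rfl
  · exact (hc.fderiv ℝ).convolutionExists_left _ (hψ.continuous_fderiv (by simp)) hv x

theorem foldr_partialDeriv_convolution {ψ v : EuclideanSpace ℝ (Fin d) → ℝ}
    (hψ : ContDiff ℝ ∞ ψ) (hc : HasCompactSupport ψ) (hv : LocallyIntegrable v)
    (l : List (Fin d)) :
    l.foldr partialDeriv (ψ ⋆[lsmul ℝ ℝ] v) = l.foldr partialDeriv ψ ⋆[lsmul ℝ ℝ] v := by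
  induction l with
  | nil => rfl
  | cons i l ih =>
    rw [List.foldr_cons, ih, partialDeriv_convolution (hψ.foldr_partialDeriv l)
      (hc.foldr_partialDeriv l) hv, List.foldr_cons]

theorem foldr_partialDeriv_const_sub {ψ : EuclideanSpace ℝ (Fin d) → ℝ}
    (hψ : ContDiff ℝ ∞ ψ) (x : EuclideanSpace ℝ (Fin d)) (l : List (Fin d)) :
    l.foldr partialDeriv (fun y => ψ (x - y)) =
      fun y => (-1) ^ l.length * l.foldr partialDeriv ψ (x - y) := by
  induction l with
  | nil => simp
  | cons i l ih =>
    funext y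
    rw [List.foldr_cons, ih]
    have h1 : HasFDerivAt (fun y => x - y)
        (-ContinuousLinearMap.id ℝ (EuclideanSpace ℝ (Fin d))) y :=
      (hasFDerivAt_id y).const_sub x
    have h2 := (((hψ.foldr_partialDeriv l).differentiable (by simp)
      (x - y)).hasFDerivAt.comp y h1).const_mul ((-1 : ℝ) ^ l.length)
    unfold partialDeriv at h2 ⊢
    have h3 := congrArg (fun A => A (EuclideanSpace.single i (1 : ℝ))) h2.fderiv
    refine Eq.trans h3 ?_
    simp [pow_succ]

/-- Differentiation falls on the kernel, and y ↦ ψ(x − y) is an admissible test function because its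
support lies in the closed ball contained in Ω. The sign from reflecting the kernel cancels the sign
in the weak derivative. -/
theorem multiDeriv_convolution_of_hasWeakDeriv {Ω : Set (EuclideanSpace ℝ (Fin d))}
    (hΩ : MeasurableSet Ω) {α : Fin d → ℕ} {u v : EuclideanSpace ℝ (Fin d) → ℝ}
    (h : HasWeakDeriv Ω α u v) (hu : IntegrableOn u Ω)
    (φ : ContDiffBump (0 : EuclideanSpace ℝ (Fin d))) {x : EuclideanSpace ℝ (Fin d)}
    (hx : Metric.closedBall x φ.rOut ⊆ Ω) :
    multiDeriv α (φ.normed volume ⋆[lsmul ℝ ℝ] Ω.indicator u) x =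
      (φ.normed volume ⋆[lsmul ℝ ℝ] Ω.indicator v) x := by
  set ψ : EuclideanSpace ℝ (Fin d) → ℝ := φ.normed volume with hψdef
  have hψ : ContDiff ℝ ∞ ψ := φ.contDiff_normed
  have hc : HasCompactSupport ψ := φ.hasCompactSupport_normed
  have hsupp : tsupport (fun y => ψ (x - y)) ⊆ Metric.closedBall x φ.rOut := by
    refine closure_minimal (fun y hy => ?_) Metric.isClosed_closedBall
    have h1 : x - y ∈ Function.support ψ := hy
    rw [hψdef, φ.support_normed_eq, mem_ball_zero_iff] at h1
    rw [Metric.mem_closedBall, dist_comm, dist_eq_norm]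
    exact h1.le
  have htest := h.2.2 (fun y => ψ (x - y)) (hψ.comp (contDiff_const.sub contDiff_id))
    (HasCompactSupport.intro' (isCompact_closedBall x φ.rOut) Metric.isClosed_closedBall
      fun y hy => Function.notMem_support.1 fun hy' => hy (hsupp (subset_tsupport _ hy')))
    (hsupp.trans hx)
  rw [multiDeriv_eq_foldr, foldr_partialDeriv_const_sub hψ, length_multiIndexList] at htest
  rw [multiDeriv_eq_foldr, foldr_partialDeriv_convolution hψ hc
    ((integrable_indicator_iff hΩ).2 hu).locallyIntegrable, convolution_eq_swap,
    convolution_eq_swap]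
  have e (a b : EuclideanSpace ℝ (Fin d) → ℝ) :
      ∫ y, lsmul ℝ ℝ (a (x - y)) (Ω.indicator b y) = ∫ y in Ω, b y * a (x - y) := by
    rw [← integral_indicator hΩ]
    refine integral_congr_ae (Filter.Eventually.of_forall fun y => ?_)
    by_cases hy : y ∈ Ω
    · simp [hy, mul_comm]
    · simp [hy]
  rw [e, e]
  have hs : ((-1 : ℝ) ^ ∑ i, α i) ≠ 0 := pow_ne_zero _ (by norm_num)
  refine mul_left_cancel₀ hs (Eq.trans ?_ htest)
  rw [← integral_const_mul]
  refine integral_congr_ae (Filter.Eventually.of_forall fun y => ?_)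
  simp only
  ring

theorem lintegral_enorm_normed (φ : ContDiffBump (0 : EuclideanSpace ℝ (Fin d))) :
    ∫⁻ x, ‖φ.normed volume x‖ₑ = 1 := by
  rw [← ofReal_integral_norm_eq_lintegral_enorm φ.integrable_normed]
  simp only [Real.norm_of_nonneg (φ.nonneg_normed _), φ.integral_normed, ENNReal.ofReal_one]

/-- The bump is a probability density, so the square of the average is at most the average of the
square; Tonelli and translation invariance finish. -/
theorem lintegral_convolution_sq_le (φ : ContDiffBump (0 : EuclideanSpace ℝ (Fin d)))
    {v : EuclideanSpace ℝ (Fin d) → ℝ} (hv : AEStronglyMeasurable v) :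
    ∫⁻ x, ‖(φ.normed volume ⋆[lsmul ℝ ℝ] v) x‖ₑ ^ 2 ≤ ∫⁻ x, ‖v x‖ₑ ^ 2 := by
  have hψm : Measurable fun z => ‖φ.normed volume z‖ₑ := φ.continuous_normed.enorm.measurable
  have hvm := hv.enorm
  have hshift (x : EuclideanSpace ℝ (Fin d)) : AEMeasurable fun z => ‖v (x - z)‖ₑ :=
    (hv.comp_quasiMeasurePreserving
      (quasiMeasurePreserving_sub_left_of_right_invariant volume x)).enorm
  set μ : Measure (EuclideanSpace ℝ (Fin d)) :=
    volume.withDensity fun z => ‖φ.normed volume z‖ₑ with hμ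
  have hμ1 : μ univ = 1 := by
    rw [hμ, withDensity_apply _ MeasurableSet.univ, Measure.restrict_univ,
      lintegral_enorm_normed]
  have hac : μ ≪ volume := withDensity_absolutelyContinuous _ _
  have hprob : IsProbabilityMeasure μ := ⟨hμ1⟩
  have hle (x : EuclideanSpace ℝ (Fin d)) :
      ‖(φ.normed volume ⋆[lsmul ℝ ℝ] v) x‖ₑ ^ 2 ≤ ∫⁻ z, ‖v (x - z)‖ₑ ^ 2 ∂μ := by
    have h1 : ‖(φ.normed volume ⋆[lsmul ℝ ℝ] v) x‖ₑ ≤ ∫⁻ z, ‖v (x - z)‖ₑ ∂μ := by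
      rw [convolution_def, hμ, lintegral_withDensity_eq_lintegral_mul₀' hψm.aemeasurable
        ((hshift x).mono_ac hac)]
      refine (enorm_integral_le_lintegral_enorm _).trans (lintegral_mono fun z => ?_)
      simp [enorm_mul]
    refine (pow_le_pow_left' h1 2).trans ((sq_lintegral_le μ ((hshift x).mono_ac hac)).trans ?_)
    rw [hμ1, one_mul]
  refine (lintegral_mono hle).trans ?_
  rw [lintegral_lintegral_swap]
  · simp only [lintegral_sub_right_eq_self (fun x => ‖v x‖ₑ ^ 2), lintegral_const, hμ1, mul_one,
      le_refl]
  · refine AEMeasurable.pow_const ?_ 2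
    have h2 : AEStronglyMeasurable (fun q : EuclideanSpace ℝ (Fin d) × EuclideanSpace ℝ (Fin d) =>
        v (q.1 - q.2)) (volume.prod volume) :=
      hv.comp_quasiMeasurePreserving
        (quasiMeasurePreserving_sub volume volume)
    exact h2.enorm.mono_ac (Measure.AbsolutelyContinuous.rfl.prod hac)

theorem enorm_convolution_le (φ : ContDiffBump (0 : EuclideanSpace ℝ (Fin d)))
    (v : EuclideanSpace ℝ (Fin d) → ℝ) (x : EuclideanSpace ℝ (Fin d)) :
    ‖(φ.normed volume ⋆[lsmul ℝ ℝ] v) x‖ₑ ≤ eLpNorm v ∞ volume := by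
  have hv : ∀ᵐ z, ‖v (x - z)‖ₑ ≤ eLpNorm v ∞ volume := by
    refine (quasiMeasurePreserving_sub_left_of_right_invariant volume x).ae
      (p := fun z => ‖v z‖ₑ ≤ eLpNorm v ∞ volume) ?_
    rw [eLpNorm_exponent_top]
    exact ae_le_eLpNormEssSup
  rw [convolution_def]
  refine (enorm_integral_le_lintegral_enorm _).trans ?_
  calc _ ≤ ∫⁻ z, ‖φ.normed volume z‖ₑ * eLpNorm v ∞ volume := by
        refine lintegral_mono_ae (hv.mono fun z hz => ?_)
        rw [ContinuousLinearMap.lsmul_apply, enorm_smul]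
        gcongr
    _ = _ := by
        rw [lintegral_mul_const _ φ.continuous_normed.enorm.measurable, lintegral_enorm_normed,
          one_mul]

end Mollification

/-! ### Openness, convexity and erosion of elements. -/

section Geometry

variable {d : ℕ}

theorem isOpen_refSimplex (d : ℕ) : IsOpen (refSimplex d) := by
  have h : refSimplex d = (⋂ i, {x | -1 < x i}) ∩ {x | ∑ i, (x i + 1) < 2} := by
    ext x
    simp [refSimplex]
  rw [h]
  refine (isOpen_iInter_of_finite fun i => ?_).inter ?_
  · exact isOpen_lt continuous_const (by fun_prop)
  · exact isOpen_lt (by fun_prop) continuous_const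

theorem convex_refSimplex (d : ℕ) : Convex ℝ (refSimplex d) := by
  rintro x ⟨hx, hx'⟩ y ⟨hy, hy'⟩ a b ha hb hab
  refine ⟨fun i => ?_, ?_⟩
  · have h : a * (x i + 1) + b * (y i + 1) > 0 := by
      rcases ha.eq_or_lt with rfl | ha
      · have : b = 1 := by linarith
        subst this
        linarith [hy i]
      · have := mul_pos ha (show 0 < x i + 1 by linarith [hx i])
        have := mul_nonneg hb (show 0 ≤ y i + 1 by linarith [hy i])
        linarith
    simp only [PiLp.add_apply, PiLp.smul_apply, smul_eq_mul]
    linarith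
  · have h : ∑ i, ((a • x + b • y) i + 1) = a * ∑ i, (x i + 1) + b * ∑ i, (y i + 1) := by
      rw [Finset.mul_sum, Finset.mul_sum, ← Finset.sum_add_distrib]
      refine Finset.sum_congr rfl fun i _ => ?_
      simp only [PiLp.add_apply, PiLp.smul_apply, smul_eq_mul]
      linear_combination -hab
    rw [h]
    rcases ha.eq_or_lt with rfl | ha
    · have : b = 1 := by linarith
      subst this
      linarith
    · have := mul_lt_mul_of_pos_left hx' ha
      have := mul_le_mul_of_nonneg_left hy'.le hb
      have : a * 2 + b * 2 = 2 := by rw [← add_mul, hab, one_mul]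
      linarith

theorem isOpen_affineElement
    (Φ : EuclideanSpace ℝ (Fin d) ≃ᴬ[ℝ] EuclideanSpace ℝ (Fin d)) :
    IsOpen (affineElement Φ) :=
  Φ.toHomeomorph.isOpenMap _ (isOpen_refSimplex d)

theorem convex_affineElement
    (Φ : EuclideanSpace ℝ (Fin d) ≃ᴬ[ℝ] EuclideanSpace ℝ (Fin d)) :
    Convex ℝ (affineElement Φ) :=
  (convex_refSimplex d).affine_image Φ.toAffineEquiv.toAffineMap

theorem isBounded_affineElement
    (Φ : EuclideanSpace ℝ (Fin d) ≃ᴬ[ℝ] EuclideanSpace ℝ (Fin d)) :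
    Bornology.IsBounded (affineElement Φ) :=
  ((isCompact_closedBall _ _).image Φ.continuous).isBounded.subset
    (image_mono (refSimplex_subset_closedBall d))

/-- The points whose closed `ε`-neighbourhood is contained in `Ω`. -/
def erosion (Ω : Set (EuclideanSpace ℝ (Fin d))) (ε : ℝ) : Set (EuclideanSpace ℝ (Fin d)) :=
  {x | Metric.closedBall x ε ⊆ Ω}

theorem erosion_subset (Ω : Set (EuclideanSpace ℝ (Fin d))) {ε : ℝ} (hε : 0 ≤ ε) :
    erosion Ω ε ⊆ Ω := fun _ hx => hx (Metric.mem_closedBall_self hε)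

theorem erosion_anti (Ω : Set (EuclideanSpace ℝ (Fin d))) {ε ε' : ℝ} (h : ε' ≤ ε) :
    erosion Ω ε ⊆ erosion Ω ε' := fun _ hx => (Metric.closedBall_subset_closedBall h).trans hx

theorem isOpen_erosion {Ω : Set (EuclideanSpace ℝ (Fin d))} (hΩ : IsOpen Ω) {ε : ℝ}
    (hε : 0 ≤ ε) : IsOpen (erosion Ω ε) := by
  -- A closed ball about x lies in Ω exactly when x lies in no closed ball of the same radius about
  -- a point of the complement.
  have h : erosion Ω ε = (Metric.cthickening ε Ωᶜ)ᶜ := by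
    ext x
    rw [Metric.cthickening_eq_biUnion_closedBall _ hε, hΩ.isClosed_compl.closure_eq]
    simp only [erosion, mem_ofPred_eq, mem_compl_iff, mem_iUnion, not_exists, Metric.mem_closedBall,
      subset_def]
    exact ⟨fun h y hy hxy => hy (h y (by rwa [dist_comm])),
      fun h y hxy => by_contra fun hy => h y hy (by rwa [dist_comm])⟩
  rw [h]
  exact Metric.isClosed_cthickening.isOpen_compl

/-- A point of the ball about a convex combination is the combination of the two endpoints shifted
by the same vector v. -/
theorem convex_erosion {Ω : Set (EuclideanSpace ℝ (Fin d))} (hΩ : Convex ℝ Ω) (ε : ℝ) :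
    Convex ℝ (erosion Ω ε) := by
  intro x hx y hy a b ha hb hab z hz
  rw [Metric.mem_closedBall, dist_eq_norm] at hz
  set v := z - (a • x + b • y) with hv
  have e : z = a • (x + v) + b • (y + v) := by
    have : a • v + b • v = v := by rw [← add_smul, hab, one_smul]
    rw [smul_add, smul_add, add_add_add_comm, this, hv]
    abel
  rw [e]
  exact hΩ (hx (by simpa using hz)) (hy (by simpa using hz)) ha hb hab

theorem eventually_mem_erosion {Ω : Set (EuclideanSpace ℝ (Fin d))} (hΩ : IsOpen Ω)
    {x : EuclideanSpace ℝ (Fin d)} (hx : x ∈ Ω) {ε : ℕ → ℝ}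
    (hε : Filter.Tendsto ε Filter.atTop (nhds 0)) :
    ∀ᶠ n in Filter.atTop, x ∈ erosion Ω (ε n) := by
  obtain ⟨δ, hδ, h⟩ := Metric.isOpen_iff.1 hΩ x hx
  filter_upwards [hε.eventually_lt_const hδ] with n hn
  exact (Metric.closedBall_subset_ball hn).trans h

end Geometry

/-! ### Weak derivatives, Sobolev norms and mollified functions. -/

section Sobolev

open scoped ContDiff Convolution
open ContinuousLinearMap (lsmul)

variable {d : ℕ} {Ω : Set (EuclideanSpace ℝ (Fin d))} {s : ℕ} {p : ℝ≥0∞}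
  {u v w : EuclideanSpace ℝ (Fin d) → ℝ} {α : Fin d → ℕ}

theorem eLpNorm_two_sq {X E : Type*} [MeasurableSpace X] [NormedAddCommGroup E] (μ : Measure X)
    (f : X → E) : eLpNorm f 2 μ ^ 2 = ∫⁻ x, ‖f x‖ₑ ^ 2 ∂μ := by
  simpa using eLpNorm_nnreal_pow_eq_lintegral (f := f) (μ := μ) (p := 2) two_ne_zero

/-- The fundamental lemma of the calculus of variations, applied to v − w. -/
theorem HasWeakDeriv.ae_eq (hΩ : IsOpen Ω) (hv : HasWeakDeriv Ω α u v)
    (hw : HasWeakDeriv Ω α u w) : v =ᵐ[volume.restrict Ω] w := by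
  have hint (a φ : EuclideanSpace ℝ (Fin d) → ℝ) (ha : LocallyIntegrableOn a Ω)
      (hφ : ContDiff ℝ ∞ φ) (hc : HasCompactSupport φ) (hs : tsupport φ ⊆ Ω) :
      Integrable (fun x => a x * φ x) := by
    have h1 : IntegrableOn a (tsupport φ) := ha.integrableOn_compact_subset hs hc
    have h2 : IntegrableOn (fun x => a x * φ x) (tsupport φ) :=
      h1.mul_continuousOn hφ.continuous.continuousOn hc
    refine (integrableOn_iff_integrable_of_support_subset fun x hx => ?_).1 h2
    exact subset_tsupport _ (right_ne_zero_of_mul (Function.mem_support.1 hx))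
  rw [Filter.EventuallyEq, ae_restrict_iff' hΩ.measurableSet]
  have key := hΩ.ae_eq_zero_of_integral_contDiff_smul_eq_zero (μ := volume) (f := v - w)
    (hv.2.1.sub hw.2.1) fun φ hφ hc hs => ?_
  · filter_upwards [key] with x hx hxΩ using sub_eq_zero.1 (hx hxΩ)
  · have h := (hv.2.2 φ hφ hc hs).symm.trans (hw.2.2 φ hφ hc hs)
    have h := mul_left_cancel₀ (pow_ne_zero _ (by norm_num)) h
    have hsupp (a : EuclideanSpace ℝ (Fin d) → ℝ) :
        ∫ x in Ω, a x * φ x = ∫ x, a x * φ x := by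
      refine setIntegral_eq_integral_of_forall_compl_eq_zero fun x hx => ?_
      rw [image_eq_zero_of_notMem_tsupport fun hx' => hx (hs hx'), mul_zero]
    rw [hsupp, hsupp] at h
    have e : (fun x => φ x • (v - w) x) = fun x => v x * φ x - w x * φ x := by
      funext x
      simp only [Pi.sub_apply, smul_eq_mul]
      ring
    rw [e, integral_sub (hint v φ hv.2.1 hφ hc hs) (hint w φ hw.2.1 hφ hc hs), h, sub_self]

theorem MemSobolev.hasWeakDeriv_weakDeriv (hu : MemSobolev Ω s p u)
    (hα : α ∈ multiIndices d s) : HasWeakDeriv Ω α u (weakDeriv Ω α u) := by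
  obtain ⟨v, hv, -⟩ := hu.2 α hα
  have h : ∃ v, HasWeakDeriv Ω α u v := ⟨v, hv⟩
  rw [weakDeriv, dif_pos h]
  exact h.choose_spec

/-- `weakDeriv` is selected by choice, so its integrability has to come, through uniqueness, from
the representative known to be in L^p. -/
theorem MemSobolev.memLp_weakDeriv (hΩ : IsOpen Ω) (hu : MemSobolev Ω s p u)
    (hα : α ∈ multiIndices d s) : MemLp (weakDeriv Ω α u) p (volume.restrict Ω) := by
  obtain ⟨v, hv, hvp⟩ := hu.2 α hα
  exact hvp.ae_eq (hv.ae_eq hΩ (hu.hasWeakDeriv_weakDeriv hα))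

theorem eLpNorm_weakDeriv_le_sobolevNorm_top (hα : α ∈ multiIndices d s) :
    eLpNorm (weakDeriv Ω α u) ∞ (volume.restrict Ω) ≤ sobolevNorm Ω s ∞ u := by
  rw [sobolevNorm, if_pos rfl]
  exact Finset.le_sup (f := fun α => eLpNorm (weakDeriv Ω α u) ∞ (volume.restrict Ω)) hα

theorem sobolevNorm_two_sq (Ω : Set (EuclideanSpace ℝ (Fin d))) (s : ℕ)
    (u : EuclideanSpace ℝ (Fin d) → ℝ) :
    sobolevNorm Ω s 2 u ^ 2 =
      ∑ α ∈ multiIndices d s, ∫⁻ x in Ω, ‖weakDeriv Ω α u x‖ₑ ^ 2 := by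
  rw [sobolevNorm, if_neg (by simp), ← ENNReal.rpow_natCast, ← ENNReal.rpow_mul]
  simp [← eLpNorm_two_sq]

theorem MemSobolev.sobolevNorm_top_ne_top (hΩ : IsOpen Ω) (hu : MemSobolev Ω s ∞ u) :
    sobolevNorm Ω s ∞ u ≠ ⊤ := by
  rw [sobolevNorm, if_pos rfl, ← lt_top_iff_ne_top, Finset.sup_lt_iff (by simp)]
  exact fun α hα => (hu.memLp_weakDeriv hΩ hα).2

theorem MemSobolev.sobolevNorm_two_ne_top (hΩ : IsOpen Ω) (hu : MemSobolev Ω s 2 u) :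
    sobolevNorm Ω s 2 u ≠ ⊤ := by
  have h : sobolevNorm Ω s 2 u ^ 2 ≠ ⊤ := by
    rw [sobolevNorm_two_sq, ENNReal.sum_ne_top]
    intro α hα
    rw [← eLpNorm_two_sq]
    exact ENNReal.pow_ne_top (hu.memLp_weakDeriv hΩ hα).2.ne
  exact fun h' => h (by rw [h']; simp)

theorem MemSobolev.integrableOn (hb : Bornology.IsBounded Ω) (hp : 1 ≤ p)
    (hu : MemSobolev Ω s p u) : IntegrableOn u Ω := by
  have : IsFiniteMeasure (volume.restrict Ω) := ⟨by simpa using hb.measure_lt_top⟩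
  exact hu.1.integrable hp

/-- The mollification of `u`, extended by zero outside `Ω`. -/
noncomputable def mollify (φ : ContDiffBump (0 : EuclideanSpace ℝ (Fin d)))
    (Ω : Set (EuclideanSpace ℝ (Fin d))) (u : EuclideanSpace ℝ (Fin d) → ℝ) :
    EuclideanSpace ℝ (Fin d) → ℝ :=
  φ.normed volume ⋆[lsmul ℝ ℝ] Ω.indicator u

theorem contDiff_mollify (φ : ContDiffBump (0 : EuclideanSpace ℝ (Fin d)))
    (hΩ : MeasurableSet Ω) (hu : IntegrableOn u Ω) : ContDiff ℝ ∞ (mollify φ Ω u) :=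
  φ.hasCompactSupport_normed.contDiff_convolution_left _ φ.contDiff_normed
    ((integrable_indicator_iff hΩ).2 hu).locallyIntegrable

theorem lintegral_mollify_sq_le (φ : ContDiffBump (0 : EuclideanSpace ℝ (Fin d)))
    (hΩ : MeasurableSet Ω) (hu : AEStronglyMeasurable u (volume.restrict Ω)) :
    ∫⁻ x, ‖mollify φ Ω u x‖ₑ ^ 2 ≤ ∫⁻ x in Ω, ‖u x‖ₑ ^ 2 := by
  refine (lintegral_convolution_sq_le φ ((aestronglyMeasurable_indicator_iff hΩ).2 hu)).trans ?_
  rw [← lintegral_indicator hΩ]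
  refine lintegral_mono fun x => ?_
  by_cases hx : x ∈ Ω <;> simp [hx]

theorem enorm_mollify_le (φ : ContDiffBump (0 : EuclideanSpace ℝ (Fin d)))
    (hΩ : MeasurableSet Ω) (u : EuclideanSpace ℝ (Fin d) → ℝ) (x : EuclideanSpace ℝ (Fin d)) :
    ‖mollify φ Ω u x‖ₑ ≤ eLpNorm u ∞ (volume.restrict Ω) := by
  rw [← eLpNorm_indicator_eq_eLpNorm_restrict hΩ]
  exact enorm_convolution_le φ _ x

theorem MemSobolev.multiDeriv_mollify (φ : ContDiffBump (0 : EuclideanSpace ℝ (Fin d)))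
    (hΩ : MeasurableSet Ω) (hb : Bornology.IsBounded Ω) (hp : 1 ≤ p) (hu : MemSobolev Ω s p u)
    (hα : α ∈ multiIndices d s) {x : EuclideanSpace ℝ (Fin d)} (hx : x ∈ erosion Ω φ.rOut) :
    multiDeriv α (mollify φ Ω u) x = mollify φ Ω (weakDeriv Ω α u) x :=
  multiDeriv_convolution_of_hasWeakDeriv hΩ (hu.hasWeakDeriv_weakDeriv hα)
    (hu.integrableOn hb hp) φ hx

theorem MemSobolev.sum_enorm_multiDeriv_mollify_le
    (φ : ContDiffBump (0 : EuclideanSpace ℝ (Fin d))) (hΩ : MeasurableSet Ω)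
    (hb : Bornology.IsBounded Ω) (hw : MemSobolev Ω s ∞ w) {x : EuclideanSpace ℝ (Fin d)}
    (hx : x ∈ erosion Ω φ.rOut) :
    ∑ α ∈ multiIndices d s, ‖multiDeriv α (mollify φ Ω w) x‖ₑ ≤
      (multiIndices d s).card * sobolevNorm Ω s ∞ w := by
  rw [← nsmul_eq_mul]
  refine Finset.sum_le_card_nsmul _ _ _ fun α hα => ?_
  rw [hw.multiDeriv_mollify φ hΩ hb le_top hα hx]
  exact (enorm_mollify_le φ hΩ _ x).trans (eLpNorm_weakDeriv_le_sobolevNorm_top hα)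

theorem MemSobolev.lintegral_sum_enorm_multiDeriv_mollify_sq_le
    (φ : ContDiffBump (0 : EuclideanSpace ℝ (Fin d))) (hΩ : IsOpen Ω)
    (hb : Bornology.IsBounded Ω) (hu : MemSobolev Ω s 2 u) :
    ∫⁻ x in erosion Ω φ.rOut,
        (∑ α ∈ multiIndices d s, ‖multiDeriv α (mollify φ Ω u) x‖ₑ) ^ 2 ≤
      (multiIndices d s).card * sobolevNorm Ω s 2 u ^ 2 := by
  have hK : MeasurableSet (erosion Ω φ.rOut) := (isOpen_erosion hΩ φ.rOut_pos.le).measurableSet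
  have hm (α : Fin d → ℕ) (hα : α ∈ multiIndices d s) :
      Measurable fun x => ‖mollify φ Ω (weakDeriv Ω α u) x‖ₑ ^ 2 := by
    refine Measurable.pow_const (Continuous.measurable (Continuous.enorm ?_)) 2
    have : IsFiniteMeasure (volume.restrict Ω) := ⟨by simpa using hb.measure_lt_top⟩
    exact (contDiff_mollify φ hΩ.measurableSet
      ((hu.memLp_weakDeriv hΩ hα).integrable (by norm_num))).continuous
  calc _ ≤ ∫⁻ x in erosion Ω φ.rOut, (multiIndices d s).card *
          ∑ α ∈ multiIndices d s, ‖mollify φ Ω (weakDeriv Ω α u) x‖ₑ ^ 2 := by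
        refine setLIntegral_mono' hK fun x hx => ?_
        rw [Finset.sum_congr rfl fun α hα => by
          rw [hu.multiDeriv_mollify φ hΩ.measurableSet hb (by norm_num) hα hx]]
        simp only [enorm_eq_nnnorm]
        exact_mod_cast sq_sum_le_card_mul_sum_sq (s := multiIndices d s)
          (f := fun α => ‖mollify φ Ω (weakDeriv Ω α u) x‖₊)
    _ = (multiIndices d s).card * ∑ α ∈ multiIndices d s,
          ∫⁻ x in erosion Ω φ.rOut, ‖mollify φ Ω (weakDeriv Ω α u) x‖ₑ ^ 2 := by
        rw [lintegral_const_mul' _ _ (by simp), lintegral_finsetSum' _ fun α hα =>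
          (hm α hα).aemeasurable]
    _ ≤ _ := by
        rw [sobolevNorm_two_sq]
        refine mul_le_mul_right (Finset.sum_le_sum fun α hα => ?_) _
        exact (setLIntegral_le_lintegral _ _).trans
          (lintegral_mollify_sq_le φ hΩ.measurableSet (hu.memLp_weakDeriv hΩ hα).1)

/-- Leibniz: the binomial coefficients sum to 2^s, and the factors d^i and d^{s−i} from passing to
multi-indices combine to d^s. -/
theorem enorm_iteratedFDeriv_mul_le {f g : EuclideanSpace ℝ (Fin d) → ℝ}
    (hf : ContDiff ℝ ∞ f) (hg : ContDiff ℝ ∞ g) (s : ℕ) (x : EuclideanSpace ℝ (Fin d)) :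
    ‖iteratedFDeriv ℝ s (fun y => f y * g y) x‖ₑ ≤
      (2 * d : ℝ≥0∞) ^ s * ((∑ α ∈ multiIndices d s, ‖multiDeriv α f x‖ₑ) *
        ∑ α ∈ multiIndices d s, ‖multiDeriv α g x‖ₑ) := by
  have hreal : ‖iteratedFDeriv ℝ s (fun y => f y * g y) x‖ ≤
      (2 * d : ℝ) ^ s * ((∑ α ∈ multiIndices d s, ‖multiDeriv α f x‖) *
        ∑ α ∈ multiIndices d s, ‖multiDeriv α g x‖) := by
    refine (norm_iteratedFDeriv_mul_le hf hg x
      (WithTop.coe_le_coe.2 (OrderTop.le_top (s : ℕ∞)))).trans ?_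
    calc _ ≤ ∑ i ∈ Finset.range (s + 1), (s.choose i : ℝ) *
          ((d : ℝ) ^ s * ((∑ α ∈ multiIndices d s, ‖multiDeriv α f x‖) *
            ∑ α ∈ multiIndices d s, ‖multiDeriv α g x‖)) := by
          refine Finset.sum_le_sum fun i hi => ?_
          have hi : i ≤ s := Nat.lt_succ_iff.1 (Finset.mem_range.1 hi)
          rw [mul_assoc]
          refine mul_le_mul_of_nonneg_left ?_ (by positivity)
          refine (mul_le_mul (norm_iteratedFDeriv_le_sum_multiDeriv hf hi x)
            (norm_iteratedFDeriv_le_sum_multiDeriv hg (Nat.sub_le s i) x)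
            (norm_nonneg _) (by positivity)).trans_eq ?_
          rw [mul_mul_mul_comm, ← pow_add, Nat.add_sub_cancel' hi]
      _ = _ := by
          rw [← Finset.sum_mul, ← Nat.cast_sum, Nat.sum_range_choose, mul_pow]
          push_cast
          ring
  rw [← ofReal_norm]
  refine (ENNReal.ofReal_le_ofReal hreal).trans_eq ?_
  rw [ENNReal.ofReal_mul (by positivity), ENNReal.ofReal_mul (by positivity),
    ENNReal.ofReal_pow (by positivity), ENNReal.ofReal_mul (by positivity),
    ENNReal.ofReal_sum_of_nonneg fun _ _ => norm_nonneg _,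
    ENNReal.ofReal_sum_of_nonneg fun _ _ => norm_nonneg _]
  simp only [ofReal_norm, ENNReal.ofReal_natCast, ENNReal.ofReal_ofNat]

end Sobolev

/-! ### Compactness of bounded polynomials of fixed degree. -/

section Compactness

open Filter Topology

variable {d : ℕ}

theorem continuous_mappedPoly (Φ : EuclideanSpace ℝ (Fin d) ≃ᴬ[ℝ] EuclideanSpace ℝ (Fin d))
    (p : MvPolynomial (Fin d) ℝ) : Continuous (mappedPoly Φ p) := by
  refine (MvPolynomial.continuous_eval p).comp (continuous_pi fun i => ?_)
  exact (EuclideanSpace.proj i : EuclideanSpace ℝ (Fin d) →L[ℝ] ℝ).continuous.comp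
    Φ.symm.continuous

theorem eq_zero_of_mappedPoly_eqOn_zero
    (Φ : EuclideanSpace ℝ (Fin d) ≃ᴬ[ℝ] EuclideanSpace ℝ (Fin d)) {p : MvPolynomial (Fin d) ℝ}
    {K : Set (EuclideanSpace ℝ (Fin d))} (hK : IsOpen K) (hne : K.Nonempty)
    (h : EqOn (mappedPoly Φ p) 0 K) : p = 0 := by
  set U : Set (Fin d → ℝ) := {ξ | Φ (WithLp.toLp 2 ξ) ∈ K} with hU
  have hUo : IsOpen U :=
    hK.preimage (Φ.continuous.comp (PiLp.continuous_toLp 2 (fun _ : Fin d => ℝ)))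
  obtain ⟨x, hx⟩ := hne
  have hxU : (Φ.symm x).ofLp ∈ U := by
    simpa [hU] using hx
  obtain ⟨ε, hε, hball⟩ := Metric.isOpen_iff.1 hUo _ hxU
  refine MvPolynomial.funext_set (fun i => Metric.ball ((Φ.symm x).ofLp i) ε) (fun i => ?_)
    fun ξ hξ => ?_
  -- A sup-norm ball is a product of intervals, each an infinite set, and a polynomial vanishing on
  -- such a product is zero.
  · rw [Real.ball_eq_Ioo]
    exact Ioo_infinite (by linarith)
  · rw [← ball_pi _ hε] at hξ
    have := h (hball hξ)
    simpa [mappedPoly] using this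

/-- A sequence of polynomials of bounded degree that is bounded in `L²` of some open set has a
pointwise convergent subsequence. -/
theorem exists_subseq_tendsto_mappedPoly
    (Φ : EuclideanSpace ℝ (Fin d) ≃ᴬ[ℝ] EuclideanSpace ℝ (Fin d)) (N : ℕ)
    {K : Set (EuclideanSpace ℝ (Fin d))} (hK : IsOpen K) (hne : K.Nonempty)
    (hsub : K ⊆ affineElement Φ) {p : ℕ → MvPolynomial (Fin d) ℝ}
    (hp : ∀ n, p n ∈ MvPolynomial.restrictTotalDegree (Fin d) ℝ N) {B : ℝ≥0∞} (hB : B ≠ ⊤)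
    (hbound : ∀ n, eLpNorm (mappedPoly Φ (p n)) 2 (volume.restrict K) ≤ B) :
    ∃ q ∈ MvPolynomial.restrictTotalDegree (Fin d) ℝ N, ∃ k : ℕ → ℕ, StrictMono k ∧
      ∀ x, Tendsto (fun n => mappedPoly Φ (p (k n)) x) atTop (𝓝 (mappedPoly Φ q x)) := by
  set V := MvPolynomial.restrictTotalDegree (Fin d) ℝ N with hV
  set e := (Module.finBasis ℝ V).equivFun with he
  set R := LpToLpRestrictCLM (EuclideanSpace ℝ (Fin d)) ℝ ℝ
    (volume.restrict (affineElement Φ)) 2 K with hR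
  set T := R.toLinearMap ∘ₗ polyToL2 Φ N with hT
  have hrestr : (volume.restrict (affineElement Φ)).restrict K = volume.restrict K :=
    Measure.restrict_restrict_of_subset hsub
  have hTae (q : V) :
      T q =ᵐ[(volume.restrict (affineElement Φ)).restrict K] mappedPoly Φ q :=
    (LpToLpRestrictCLM_coeFn ℝ K _).trans
      (ae_restrict_of_ae (memLp_mappedPoly Φ q 2).coeFn_toLp)
  have hker : LinearMap.ker (T ∘ₗ e.symm.toLinearMap) = ⊥ := by
    rw [LinearMap.ker_eq_bot']
    intro c hc
    have h0 : T (e.symm c) = 0 := hc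
    have h1 : mappedPoly Φ (e.symm c)
        =ᵐ[(volume.restrict (affineElement Φ)).restrict K] 0 := by
      refine (hTae _).symm.trans ?_
      rw [h0]
      exact Lp.coeFn_zero _ _ _
    rw [hrestr] at h1
    have h2 := eq_zero_of_mappedPoly_eqOn_zero Φ hK hne
      (Measure.eqOn_open_of_ae_eq h1 hK (continuous_mappedPoly Φ _).continuousOn
        continuousOn_const)
    exact (map_eq_zero_iff e.symm e.symm.injective).1 (Subtype.ext h2)
  -- An injective linear map on a finite-dimensional space is bounded below, so the L² bound on `K`
  -- bounds the coordinates.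
  obtain ⟨c, -, hc⟩ := LinearMap.exists_antilipschitzWith _ hker
  set a : ℕ → Fin (Module.finrank ℝ V) → ℝ := fun n => e ⟨p n, hp n⟩ with ha
  have hle (n : ℕ) : a n ∈ Metric.closedBall (0 : Fin (Module.finrank ℝ V) → ℝ)
      (c * B.toReal) := by
    rw [mem_closedBall_zero_iff]
    have h1 := hc.le_mul_dist (a n) 0
    rw [map_zero, dist_zero_right, dist_zero_right] at h1
    refine h1.trans (mul_le_mul_of_nonneg_left ?_ c.2)
    have h2 : (T ∘ₗ e.symm.toLinearMap) (a n) = T ⟨p n, hp n⟩ := by simp [ha]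
    rw [h2, Lp.norm_def]
    refine ENNReal.toReal_mono hB ?_
    rw [eLpNorm_congr_ae (hTae _), hrestr]
    exact hbound n
  obtain ⟨b, -, k, hk, hlim⟩ := tendsto_subseq_of_bounded Metric.isBounded_closedBall hle
  refine ⟨e.symm b, (e.symm b).2, k, hk, fun x => ?_⟩
  let ev : V →ₗ[ℝ] ℝ :=
    (MvPolynomial.aeval (fun i => Φ.symm x i) : MvPolynomial (Fin d) ℝ →ₐ[ℝ] ℝ).toLinearMap ∘ₗ
      V.subtype
  have hev (q : V) : ev q = mappedPoly Φ q x := by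
    simp [ev, mappedPoly, MvPolynomial.aeval_eq_eval]
  have hcont : Continuous (ev ∘ₗ e.symm.toLinearMap) := LinearMap.continuous_of_finiteDimensional _
  have := (hcont.tendsto b).comp hlim
  rw [← hev]
  refine this.congr fun n => ?_
  rw [← hev ⟨p (k n), hp (k n)⟩]
  simp [ha]

end Compactness

/-! ### Polynomial approximation of the product uw. -/

section Approximation

open Filter Topology
open scoped ContDiff

variable {d : ℕ}

/-- The bump functions used for mollification. -/
noncomputable def mollifierBump (d n : ℕ) : ContDiffBump (0 : EuclideanSpace ℝ (Fin d)) where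
  rIn := 1 / (n + 1) / 2
  rOut := 1 / (n + 1)
  rIn_pos := by positivity
  rIn_lt_rOut := half_lt_self (by positivity)

theorem ae_tendsto_mollify {Ω : Set (EuclideanSpace ℝ (Fin d))} (hΩ : MeasurableSet Ω)
    {u : EuclideanSpace ℝ (Fin d) → ℝ} (hu : IntegrableOn u Ω) :
    ∀ᵐ x ∂(volume.restrict Ω),
      Tendsto (fun n => mollify (mollifierBump d n) Ω u x) atTop (𝓝 (u x)) := by
  rw [ae_restrict_iff' hΩ]
  -- `K := 2` is the ratio of outer to inner radius of the bumps; its boundedness is what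
  -- convergence almost everywhere requires.
  have := ContDiffBump.ae_convolution_tendsto_right_of_locallyIntegrable (μ := volume)
    (φ := mollifierBump d) (l := atTop) (K := 2) tendsto_one_div_add_atTop_nhds_zero_nat
    (Eventually.of_forall fun n => by simp only [mollifierBump]; linarith)
    ((integrable_indicator_iff hΩ).2 hu).locallyIntegrable
  filter_upwards [this] with x hx hxΩ
  rwa [indicator_of_mem hxΩ] at hx

/-- The constant of the approximation theorem. -/
def approxConst (d s : ℕ) : ℕ := 2 ^ d * ((2 * d) ^ s * (multiIndices d s).card ^ 2)

/-- The approximation of a product of smooth functions, after mollification. -/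
theorem exists_mappedPoly_approx_mollify
    (Φ : EuclideanSpace ℝ (Fin d) ≃ᴬ[ℝ] EuclideanSpace ℝ (Fin d)) (N : ℕ)
    {u w : EuclideanSpace ℝ (Fin d) → ℝ} (hw : MemSobolev (affineElement Φ) (N + 1) ∞ w)
    (hu : MemSobolev (affineElement Φ) (N + 1) 2 u)
    (φ : ContDiffBump (0 : EuclideanSpace ℝ (Fin d)))
    (hne : (erosion (affineElement Φ) φ.rOut).Nonempty) :
    ∃ p ∈ MvPolynomial.restrictTotalDegree (Fin d) ℝ N,
      eLpNorm (fun x => mollify φ (affineElement Φ) u x * mollify φ (affineElement Φ) w x -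
        mappedPoly Φ p x) 2 (volume.restrict (erosion (affineElement Φ) φ.rOut)) ≤
      approxConst d (N + 1) * ENNReal.ofReal (Metric.diam (affineElement Φ)) ^ (N + 1) *
        sobolevNorm (affineElement Φ) (N + 1) ∞ w * sobolevNorm (affineElement Φ) (N + 1) 2 u := by
  have hΩ := isOpen_affineElement Φ
  have hb := isBounded_affineElement Φ
  set Ω := affineElement Φ with hΩdef
  set K := erosion Ω φ.rOut with hKdef
  have hKsub : K ⊆ Ω := erosion_subset Ω φ.rOut_pos.le
  have hKo : IsOpen K := isOpen_erosion hΩ φ.rOut_pos.le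
  have hfu := contDiff_mollify φ hΩ.measurableSet (hu.integrableOn hb (by norm_num))
  have hfw := contDiff_mollify φ hΩ.measurableSet (hw.integrableOn hb le_top)
  obtain ⟨p, hp, h⟩ := exists_mappedPoly_approx_of_contDiff Φ N hKo.measurableSet
    (convex_erosion (convex_affineElement Φ) _) (hKo.measure_pos volume hne).ne'
    (hb.subset hKsub).measure_lt_top.ne (h := ENNReal.ofReal (Metric.diam Ω))
    (fun x hx y hy => by
      rw [← ofReal_norm, ← dist_eq_norm]
      exact ENNReal.ofReal_le_ofReal (Metric.dist_le_diam_of_mem hb (hKsub hx) (hKsub hy)))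
    (hfu.mul hfw)
  refine ⟨p, hp, ?_⟩
  rw [← ENNReal.pow_le_pow_left_iff two_ne_zero, eLpNorm_two_sq]
  refine h.trans ?_
  set W := sobolevNorm Ω (N + 1) ∞ w with hW
  set U := sobolevNorm Ω (N + 1) 2 u with hU
  set M : ℝ≥0∞ := ((multiIndices d (N + 1)).card : ℝ≥0∞) with hM
  set A : ℝ≥0∞ := (2 * d) ^ (N + 1) with hA
  have hWtop : W ≠ ⊤ := hw.sobolevNorm_top_ne_top hΩ
  have key : ∫⁻ x in K, ‖iteratedFDeriv ℝ (N + 1)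
      (fun x => mollify φ Ω u x * mollify φ Ω w x) x‖ₑ ^ 2 ≤
      (A * (M * W)) ^ 2 * (M * U ^ 2) := by
    calc _ ≤ ∫⁻ x in K, (A * (M * W)) ^ 2 *
          (∑ α ∈ multiIndices d (N + 1), ‖multiDeriv α (mollify φ Ω u) x‖ₑ) ^ 2 := by
          refine setLIntegral_mono' hKo.measurableSet fun x hx => ?_
          rw [← mul_pow]
          refine pow_le_pow_left' ((enorm_iteratedFDeriv_mul_le hfu hfw (N + 1) x).trans ?_) 2
          rw [mul_assoc, mul_comm (M * W)]
          gcongr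
          exact hw.sum_enorm_multiDeriv_mollify_le φ hΩ.measurableSet hb hx
      _ ≤ _ := by
          rw [lintegral_const_mul']
          · gcongr
            exact hu.lintegral_sum_enorm_multiDeriv_mollify_sq_le φ hΩ hb
          · exact ENNReal.pow_ne_top (ENNReal.mul_ne_top
              (ENNReal.pow_ne_top (ENNReal.mul_ne_top (by simp) (by simp)))
              (ENNReal.mul_ne_top (by simp [hM]) hWtop))
  have hM1 : 1 ≤ M := by
    have : 0 < (multiIndices d (N + 1)).card :=
      Finset.card_pos.2 ⟨0, mem_multiIndices.2 (by simp)⟩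
    rw [hM]
    exact_mod_cast this
  -- The squared estimate carries 2^d and M³. Enlarging them to (2^d)² and M⁴ makes the bound a
  -- perfect square, namely that of the claimed right-hand side.
  have h2 : (2 : ℝ≥0∞) ^ d ≤ (2 ^ d) ^ 2 :=
    le_self_pow₀ (one_le_pow₀ one_le_two) two_ne_zero
  set D := ENNReal.ofReal (Metric.diam Ω) with hD
  calc _ ≤ D ^ (2 * (N + 1)) * ((2 ^ d) ^ 2 * ((A * (M * W)) ^ 2 * (M ^ 2 * U ^ 2))) := by
        refine mul_le_mul_right (mul_le_mul' h2 (key.trans ?_)) _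
        gcongr
        exact le_self_pow₀ hM1 two_ne_zero
    _ = _ := by
        rw [approxConst]
        push_cast
        rw [← hA, ← hM]
        ring

/-- The mollified estimates hold on eroded sets exhausting D with one bound R, so only a passage to
the limit remains. -/
theorem exists_mappedPoly_approx_mul
    (Φ : EuclideanSpace ℝ (Fin d) ≃ᴬ[ℝ] EuclideanSpace ℝ (Fin d)) (N : ℕ)
    (hne : (affineElement Φ).Nonempty)
    {u w : EuclideanSpace ℝ (Fin d) → ℝ} (hw : MemSobolev (affineElement Φ) (N + 1) ∞ w)
    (hu : MemSobolev (affineElement Φ) (N + 1) 2 u) :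
    ∃ p ∈ MvPolynomial.restrictTotalDegree (Fin d) ℝ N,
      eLpNorm (fun x => u x * w x - mappedPoly Φ p x) 2 (volume.restrict (affineElement Φ)) ≤
      approxConst d (N + 1) * ENNReal.ofReal (Metric.diam (affineElement Φ)) ^ (N + 1) *
        sobolevNorm (affineElement Φ) (N + 1) ∞ w * sobolevNorm (affineElement Φ) (N + 1) 2 u := by
  have hΩ := isOpen_affineElement Φ
  have hb := isBounded_affineElement Φ
  set R := approxConst d (N + 1) * ENNReal.ofReal (Metric.diam (affineElement Φ)) ^ (N + 1) *
    sobolevNorm (affineElement Φ) (N + 1) ∞ w * sobolevNorm (affineElement Φ) (N + 1) 2 u with hR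
  have hRtop : R ≠ ⊤ := ENNReal.mul_ne_top (ENNReal.mul_ne_top (ENNReal.mul_ne_top (by simp)
    (by finiteness)) (hw.sobolevNorm_top_ne_top hΩ)) (hu.sobolevNorm_two_ne_top hΩ)
  set Ω := affineElement Φ with hΩdef
  have hε : Tendsto (fun n : ℕ => (1 : ℝ) / (n + 1)) atTop (𝓝 0) :=
    tendsto_one_div_add_atTop_nhds_zero_nat
  obtain ⟨x₀, hx₀⟩ := hne
  -- The index m fixes one nonempty open set `K m`, contained in all later erosions, on which every
  -- polynomial is measured.
  obtain ⟨m, hm⟩ := (eventually_mem_erosion hΩ hx₀ hε).exists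
  set K : ℕ → Set (EuclideanSpace ℝ (Fin d)) := fun n => erosion Ω (1 / ((n : ℝ) + 1)) with hK
  have hKo (n : ℕ) : IsOpen (K n) := isOpen_erosion hΩ (by positivity)
  have hmono (n : ℕ) : K m ⊆ K (m + n) :=
    erosion_anti Ω (one_div_le_one_div_of_le (by positivity) (by push_cast; linarith))
  set g : ℕ → EuclideanSpace ℝ (Fin d) → ℝ := fun n x =>
    mollify (mollifierBump d n) Ω u x * mollify (mollifierBump d n) Ω w x with hg
  have hui := hu.integrableOn hb (by norm_num)
  have hwi := hw.integrableOn hb le_top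
  have hgc (n : ℕ) : Continuous (g n) :=
    (contDiff_mollify _ hΩ.measurableSet hui).continuous.mul
      (contDiff_mollify _ hΩ.measurableSet hwi).continuous
  have happrox (n : ℕ) := exists_mappedPoly_approx_mollify Φ N hw hu (mollifierBump d (m + n))
    ⟨x₀, hmono n hm⟩
  choose p hp hpR using happrox
  have hgL2 (n : ℕ) : eLpNorm (g n) 2 (volume.restrict (K m)) ≤
      eLpNorm w ∞ (volume.restrict Ω) * eLpNorm u 2 (volume.restrict Ω) := by
    rw [← ENNReal.pow_le_pow_left_iff two_ne_zero, eLpNorm_two_sq, mul_pow]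
    calc _ ≤ ∫⁻ x, eLpNorm w ∞ (volume.restrict Ω) ^ 2 *
          ‖mollify (mollifierBump d n) Ω u x‖ₑ ^ 2 := by
          refine (setLIntegral_le_lintegral _ _).trans (lintegral_mono fun x => ?_)
          simp only [hg, enorm_mul]
          rw [mul_comm, mul_pow]
          gcongr
          exact enorm_mollify_le _ hΩ.measurableSet w x
      _ ≤ _ := by
          rw [lintegral_const_mul' _ _ (ENNReal.pow_ne_top hw.1.2.ne)]
          rw [eLpNorm_two_sq]
          exact mul_le_mul_right (lintegral_mollify_sq_le _ hΩ.measurableSet hu.1.1) _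
  have hbound (n : ℕ) : eLpNorm (mappedPoly Φ (p n)) 2 (volume.restrict (K m)) ≤
      eLpNorm w ∞ (volume.restrict Ω) * eLpNorm u 2 (volume.restrict Ω) + R := by
    have e : mappedPoly Φ (p n) = g (m + n) - fun x => g (m + n) x - mappedPoly Φ (p n) x := by
      funext x; simp
    rw [e]
    refine (eLpNorm_sub_le (hgc _).aestronglyMeasurable
      ((hgc _).sub (continuous_mappedPoly Φ _)).aestronglyMeasurable (by norm_num)).trans ?_
    exact add_le_add (hgL2 _)
      ((eLpNorm_mono_measure _ (Measure.restrict_mono_set _ (hmono n))).trans (hpR n))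
  obtain ⟨q, hq, k, hk, hlim⟩ := exists_subseq_tendsto_mappedPoly Φ N (hKo m) ⟨x₀, hm⟩
    (erosion_subset Ω (by positivity)) hp
    (ENNReal.add_ne_top.2 ⟨ENNReal.mul_ne_top hw.1.2.ne hu.1.2.ne, hRtop⟩) hbound
  refine ⟨q, hq, ?_⟩
  rw [← ENNReal.pow_le_pow_left_iff two_ne_zero, eLpNorm_two_sq]
  -- The indicators put the estimates on varying sets onto the fixed set Ω. Each point of Ω lies in
  -- all sufficiently late erosions, so the indicators do not affect the limit and Fatou's lemma
  -- applies.
  set F : ℕ → EuclideanSpace ℝ (Fin d) → ℝ≥0∞ := fun n => (K (m + k n)).indicator fun x =>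
    ‖g (m + k n) x - mappedPoly Φ (p (k n)) x‖ₑ ^ 2 with hF
  have hFm (n : ℕ) : Measurable (F n) :=
    (((hgc _).sub (continuous_mappedPoly Φ _)).enorm.measurable.pow_const 2).indicator
      (hKo _).measurableSet
  have hFint (n : ℕ) : ∫⁻ x in Ω, F n x ≤ R ^ 2 := by
    refine (setLIntegral_le_lintegral _ _).trans ?_
    rw [lintegral_indicator (hKo _).measurableSet, ← eLpNorm_two_sq]
    exact pow_le_pow_left' (hpR (k n)) 2
  have hidx : Tendsto (fun n => m + k n) atTop atTop :=
    tendsto_atTop_mono (fun n => Nat.le_add_left _ _) hk.tendsto_atTop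
  have hFlim : ∀ᵐ x ∂(volume.restrict Ω),
      ‖u x * w x - mappedPoly Φ q x‖ₑ ^ 2 = liminf (fun n => F n x) atTop := by
    filter_upwards [ae_tendsto_mollify hΩ.measurableSet hui,
      ae_tendsto_mollify hΩ.measurableSet hwi, ae_restrict_mem hΩ.measurableSet]
      with x hxu hxw hxΩ
    have h1 : Tendsto (fun n => ‖g (m + k n) x - mappedPoly Φ (p (k n)) x‖ₑ ^ 2) atTop
        (𝓝 (‖u x * w x - mappedPoly Φ q x‖ₑ ^ 2)) :=
      (((ENNReal.continuous_pow 2).comp continuous_enorm).tendsto _).comp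
        (((hxu.mul hxw).comp hidx).sub (hlim x))
    refine (Tendsto.liminf_eq (h1.congr' ?_)).symm
    filter_upwards [hidx.eventually (eventually_mem_erosion hΩ hxΩ hε)] with n hn
    have hn' : x ∈ K (m + k n) := hn
    simp only [hF, indicator_of_mem hn']
  rw [lintegral_congr_ae hFlim]
  refine (lintegral_liminf_le hFm).trans ?_
  refine (liminf_le_liminf (Eventually.of_forall hFint)).trans ?_
  simp

end Approximation

/-! ### Best approximation by the projection, and the weighted estimate. -/

theorem eLpNorm_sub_l2Proj_le {d : ℕ}
    (Φ : EuclideanSpace ℝ (Fin d) ≃ᴬ[ℝ] EuclideanSpace ℝ (Fin d)) (N : ℕ)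
    {f : EuclideanSpace ℝ (Fin d) → ℝ} (hf : MemLp f 2 (volume.restrict (affineElement Φ)))
    {p : MvPolynomial (Fin d) ℝ} (hp : p ∈ MvPolynomial.restrictTotalDegree (Fin d) ℝ N) :
    eLpNorm (fun x => f x - l2Proj Φ N hf.toLp x) 2 (volume.restrict (affineElement Φ)) ≤
      eLpNorm (fun x => f x - mappedPoly Φ p x) 2 (volume.restrict (affineElement Φ)) := by
  have hmem : polyToL2 Φ N ⟨p, hp⟩ ∈ polySpace Φ N := LinearMap.mem_range_self _ _
  have hnorm : ‖hf.toLp - l2Proj Φ N hf.toLp‖ ≤ ‖hf.toLp - polyToL2 Φ N ⟨p, hp⟩‖ := by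
    have h := (polySpace Φ N).starProjection_minimal hf.toLp
    rw [l2Proj, h]
    exact ciInf_le ⟨0, by rintro _ ⟨y, rfl⟩; exact norm_nonneg _⟩
      (⟨_, hmem⟩ : polySpace Φ N)
  have hconv (g : Lp ℝ 2 (volume.restrict (affineElement Φ)))
      (g' : EuclideanSpace ℝ (Fin d) → ℝ) (hg : g =ᵐ[volume.restrict (affineElement Φ)] g') :
      eLpNorm (fun x => f x - g' x) 2 (volume.restrict (affineElement Φ)) = ‖hf.toLp - g‖ₑ := by
    rw [Lp.enorm_def]
    refine eLpNorm_congr_ae ?_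
    filter_upwards [Lp.coeFn_sub hf.toLp g, hf.coeFn_toLp, hg] with x h1 h2 h3
    rw [h1, Pi.sub_apply, h2, h3]
  rw [hconv _ _ (Filter.EventuallyEq.refl _ _),
    hconv (polyToL2 Φ N ⟨p, hp⟩) _ (memLp_mappedPoly Φ p 2).coeFn_toLp, ← ofReal_norm, ← ofReal_norm]
  exact ENNReal.ofReal_le_ofReal hnorm

theorem mainTheorem5 (d : ℕ) (hd : 0 < d) (N : ℕ) (σ : ℝ) :
    ∃ C : ℝ≥0, ∀ Φ : EuclideanSpace ℝ (Fin d) ≃ᴬ[ℝ] EuclideanSpace ℝ (Fin d),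
      IsQuasiRegular σ (affineElement Φ) →
      ∀ w u : EuclideanSpace ℝ (Fin d) → ℝ,
        MemSobolev (affineElement Φ) (N + 1) ∞ w →
        (∀ᵐ x ∂(volume.restrict (affineElement Φ)), w x ≠ 0) →
        MemSobolev (affineElement Φ) (N + 1) 2 u →
        ∃ huw : MemLp (fun x => u x * w x) 2 (volume.restrict (affineElement Φ)),
          eLpNorm (fun x => u x - 1 / w x * l2Proj Φ N huw.toLp x) 2
              (volume.restrict (affineElement Φ)) ≤
            C * ENNReal.ofReal (Metric.diam (affineElement Φ)) ^ (N + 1) *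
              eLpNorm (fun x => 1 / w x) ∞ (volume.restrict (affineElement Φ)) *
              sobolevNorm (affineElement Φ) (N + 1) ∞ w *
              sobolevNorm (affineElement Φ) (N + 1) 2 u := by
  refine ⟨approxConst d (N + 1), fun Φ ⟨c, r, hr, hball, _⟩ w u hw hw0 hu => ?_⟩
  have hne : (affineElement Φ).Nonempty := ⟨c, hball (Metric.mem_ball_self hr)⟩
  have huw : MemLp (fun x => u x * w x) 2 (volume.restrict (affineElement Φ)) :=
    hw.1.mul' hu.1
  refine ⟨huw, ?_⟩
  obtain ⟨p, hp, hbound⟩ := exists_mappedPoly_approx_mul Φ N hne hw hu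
  -- Since w ≠ 0 almost everywhere, u = (1/w)(uw), so 1/w factors out of the error and is estimated
  -- in L^∞.
  have hfactor : (fun x => u x - 1 / w x * l2Proj Φ N huw.toLp x) =ᵐ[
      volume.restrict (affineElement Φ)]
      (fun x => 1 / w x) • fun x => u x * w x - l2Proj Φ N huw.toLp x := by
    filter_upwards [hw0] with x hx
    simp only [Pi.smul_apply', smul_eq_mul]
    field_simp
  rw [eLpNorm_congr_ae hfactor]
  refine (eLpNorm_smul_le_eLpNorm_top_mul_eLpNorm 2
    (huw.1.sub (Lp.aestronglyMeasurable _)) _).trans ?_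
  refine (mul_le_mul_right ((eLpNorm_sub_l2Proj_le Φ N huw hp).trans hbound) _).trans_eq ?_
  push_cast
  ring
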